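/- Let $L>0$, let $q\in\mathcal L_2[0,L]$ be complex valued and $h\in\mathbb C$. For $\rho\in\mathbb C$ let $S(\rho,\cdot)$ and $\phi(\rho,\cdot)$ be the solutions of $-y''+q(x)y=\rho^2y$ on $(0,L)$ (that is, $y'$ is absolutely continuous on $[0,L]$ and the equation holds almost everywhere) with $S(\rho,0)=0$, $S'(\rho,0)=1$, $\phi(\rho,0)=1$, $\phi'(\rho,0)=h$, where $'$ denotes $d/dx$. Put $\omega(x)=\frac12\int_0^xq(s)\,ds$, $\operatorname{sinc}(z)=\frac{\sin \pi z}{\pi z}$, $\operatorname{sinc}(0)=1$, and let $j_1$ be the spherical Bessel function of order $1$. Let $x\in(0,L]$. Then, for all $\rho\in\mathbb C$, $$S'(\rho,x)=\cos(\rho x)+\frac{\omega(x)}{\rho}\sin(\rho x)+\frac{1}{2\rho\sin(\rho x)}\sum_{n=0}^{\infty}\mathring s_n(x)\left(\operatorname{sinc}\left(\tfrac{2\rho x}{\pi}-2n-1\right)+\operatorname{sinc}\left(\tfrac{2\rho x}{\pi}+2n+1\right)\right),\qquad(1)$$ where the right-hand side is understood as a limit at the points $\rho$ with $\rho\sin(\rho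 x)=0$, and $$\mathring s_n(x)=\frac{(-1)^n(2n+1)\pi}{x}\,S'\left(\tfrac{(2n+1)\pi}{2x},x\right)-2\omega(x),\quad n=0,1,\dots;$$ and, for all $\rho\in\mathbb C$, $$\phi'(\rho,x)=-\rho\sin(\rho x)-(h+\omega(x))\,\rho x\,j_1(\rho x)+\sum_{n=0}^{\infty}\mathring\phi_n(x)\left(\operatorname{sinc}\left(\tfrac{\rho x}{\pi}-n\right)+\operatorname{sinc}\left(\tfrac{\rho x}{\pi}+n\right)\right),\qquad(2)$$ where $$\mathring\phi_0(x)=\tfrac12\phi'(0,x),\qquad \mathring\phi_n(x)=\phi'\left(\tfrac{n\pi}{x},x\right)-(-1)^n(h+\omega(x)),\quad n=1,2,\dots.$$ The series in (1) (both the sum itself and the sum multiplied termwise by $\frac1{2\rho\sin(\rho x)}$, the latter considered for $\rho\sin(\rho x)\ne0$) and the series in (2) converge pointwise, and uniformly on any compact subset of the complex plane of the variable $\rho$. For $\rho$ on the real line, their terms and sums belong to $\mathcal L_2(\mathbb R)$, and the convergence holds in the norm of $\mathcal L_2(\mathbb R)$, absolutely and uniformly. -/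

import Mathlib

open MeasureTheory Set Filter
open scoped Topology

noncomputable section

namespace CardinalSeries

/-- The normalized sinc function on `ℂ`. -/
def sinc (z : ℂ) : ℂ :=
  if z = 0 then 1 else Complex.sin (Real.pi * z) / (Real.pi * z)

/-- The spherical Bessel function of the first kind of order `n`, by its (everywhere convergent)
ascending series `j_n(z) = z ^ n ∑ (-z²/2)^k / (k! (2n+2k+1)!!)`. -/
def sphericalBesselJ (n : ℕ) (z : ℂ) : ℂ :=
  z ^ n * ∑' k : ℕ, (-(z ^ 2 / 2)) ^ k /
    ((Nat.factorial k : ℂ) * (Nat.doubleFactorial (2 * n + 2 * k + 1) : ℂ))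

/-- The derivative with respect to `x` on `[0, L]` (one-sided at the endpoints). -/
def xDeriv (L : ℝ) (y : ℝ → ℂ) (x : ℝ) : ℂ := derivWithin y (Icc 0 L) x

/-- `y` is a (Carathéodory) solution of `-y'' + q y = ρ² y` on `[0, L]`: `y` is differentiable,
`y'` is absolutely continuous, and the equation holds almost everywhere; moreover `y` has the
initial values `y(0) = a`, `y'(0) = b`. -/
structure IsSolution (L : ℝ) (q : ℝ → ℂ) (ρ a b : ℂ) (y : ℝ → ℂ) : Prop where
  differentiableOn : DifferentiableOn ℝ y (Icc 0 L)
  absolutelyContinuous : AbsolutelyContinuousOnInterval (xDeriv L y) 0 L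
  equation : ∀ᵐ x : ℝ, x ∈ Ioo 0 L →
    ∃ y₂ : ℂ, HasDerivAt (xDeriv L y) y₂ x ∧ -y₂ + q x * y x = ρ ^ 2 * y x
  initial_value : y 0 = a
  initial_deriv : xDeriv L y 0 = b

/-- `ω(x) = ½ ∫₀ˣ q(s) ds`. -/
def omega (q : ℝ → ℂ) (x : ℝ) : ℂ := (1 / 2) * ∫ s in (0 : ℝ)..x, q s

/-- `sinc(2ρx/π - 2n - 1) + sinc(2ρx/π + 2n + 1)`. -/
def oddKernel (x : ℝ) (n : ℕ) (ρ : ℂ) : ℂ :=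
  sinc (2 * ρ * x / Real.pi - 2 * n - 1) + sinc (2 * ρ * x / Real.pi + 2 * n + 1)

/-- `sinc(ρx/π - n) + sinc(ρx/π + n)`. -/
def evenKernel (x : ℝ) (n : ℕ) (ρ : ℂ) : ℂ :=
  sinc (ρ * x / Real.pi - n) + sinc (ρ * x / Real.pi + n)

/-- The coefficients of the series for `S'`, from the samples of `S'` at `(2n+1)π/(2x)`. -/
def sCoeff (L : ℝ) (q : ℝ → ℂ) (S : ℂ → ℝ → ℂ) (x : ℝ) (n : ℕ) : ℂ :=
  (-1) ^ n * (2 * n + 1) * Real.pi / x *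
    xDeriv L (S ((2 * n + 1) * Real.pi / (2 * x))) x - 2 * omega q x

/-- The coefficients of the series for `φ'`, from the samples of `φ'` at `nπ/x`. -/
def phiCoeff (L : ℝ) (q : ℝ → ℂ) (h : ℂ) (φ : ℂ → ℝ → ℂ) (x : ℝ) (n : ℕ) : ℂ :=
  if n = 0 then xDeriv L (φ 0) x / 2
  else xDeriv L (φ (n * Real.pi / x)) x - (-1) ^ n * (h + omega q x)

/-- The convergence properties of a series `∑ u n ρ` of functions of `ρ`, whose terms are
considered on the set `D ⊆ ℂ`: pointwise convergence on `D`, uniform convergence on the compact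
subsets of the plane (intersected with `D`), and, for real `ρ`, absolute convergence, uniform
convergence and convergence in `L²(ℝ)`. -/
structure CardinalConvergence (D : Set ℂ) (u : ℕ → ℂ → ℂ) : Prop where
  summable : ∀ ρ ∈ D, Summable fun n => u n ρ
  uniform_compact : ∀ K : Set ℂ, IsCompact K →
    TendstoUniformlyOn (fun (N : ℕ) ρ => ∑ n ∈ Finset.range N, u n ρ)
      (fun ρ => ∑' n, u n ρ) atTop (K ∩ D)
  absolute_real : ∀ t : ℝ, (t : ℂ) ∈ D → Summable fun n => ‖u n t‖
  uniform_real : TendstoUniformlyOn (fun (N : ℕ) (t : ℝ) => ∑ n ∈ Finset.range N, u n t)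
    (fun t : ℝ => ∑' n, u n t) atTop {t : ℝ | (t : ℂ) ∈ D}
  memLp_term : ∀ n, MemLp (fun t : ℝ => u n t) 2 volume
  memLp_sum : MemLp (fun t : ℝ => ∑' n, u n t) 2 volume
  tendsto_L2 : Tendsto (fun N : ℕ => eLpNorm
    (fun t : ℝ => (∑' n, u n t) - ∑ n ∈ Finset.range N, u n t) 2 volume) atTop (𝓝 0)

end CardinalSeries

end

namespace CardinalSeries

/-! Variation of constants writes the remainder F(ρ) = S'(ρ,x) - cos ρx - ω(x) sin(ρx)/ρ as ∫₀ˣ q(s)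
(S(ρ,s) cos ρ(x-s) - sin(ρx)/(2ρ)) ds, and similarly φ' + ρ sin ρx - (h+ω) cos ρx with φ and cos ρx
in place of S and sin(ρx)/ρ. Both series are sampling expansions of these remainders.

Classically a transmutation kernel shows that the remainders are of Paley–Wiener type. Here a
boundedness statement, `IsL2Bounded`, takes its place: F is a functional of the profile t ↦
sin(ρt)/ρ (for φ: cos ρt), bounded on finite linear combinations in the norm of L²(-x,x). The reason
is that S(ρ,s) cos ρt solves u_ss - q u = u_tt, an equation independent of ρ, so Σ aᵢ S(ρᵢ,s) cos
ρᵢt is a solution with data P = Σ aᵢ sin(ρᵢt)/ρᵢ. The free wave on the characteristic s + t = x is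
(P(x) + P(2s-x))/2. The point value P(x) is not controlled in L², and subtracting it is what
produces ω(x); the rest pairs with q ∈ L² by Cauchy–Schwarz (`exists_wave_trace_bound`,
`isL2Bounded_of_volterra`).

By Parseval the L² norm of a combination of profiles is equivalent to the ℓ² norm of its Fourier
coefficients, which are sinc kernels: integer nodes for cos ρt, and half-integer nodes for sin(ρt)/ρ
after a half-frequency shift (`isParsevalKernel_even`, `isParsevalKernel_half`). Since the kernels
interpolate at the sampling points, testing the bound on sample profiles gives square summable
samples, and testing it on a profile minus its partial cardinal sum gives the expansion
(`summable_sq_samples`, `hasSum_samples`).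

All modes of convergence follow from two Bessel inequalities for the kernels, one pointwise in
horizontal strips and one in L²(ℝ) (`cardinalConvergence_of_bessel`). The printed forms come from
sinc(2u) = cos(πu) sinc(u) and sinc(z) - cos πz = πz j₁(πz). -/

/-! ### The fundamental theorem of calculus for absolutely continuous functions -/

theorem absolutelyContinuousOnInterval_of_dist_le {X Y : Type*} [PseudoMetricSpace X]
    [PseudoMetricSpace Y] {f : ℝ → X} {g : ℝ → Y} {a b : ℝ}
    (hf : AbsolutelyContinuousOnInterval f a b)
    (h : ∀ s t, dist (g s) (g t) ≤ dist (f s) (f t)) :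
    AbsolutelyContinuousOnInterval g a b :=
  squeeze_zero (fun _ => Finset.sum_nonneg fun _ _ => dist_nonneg)
    (fun _ => Finset.sum_le_sum fun _ _ => h _ _) hf

theorem intervalIntegrable_ofReal {f : ℝ → ℝ} {a b : ℝ} (h : IntervalIntegrable f volume a b) :
    IntervalIntegrable (fun x => (f x : ℂ)) volume a b :=
  ⟨h.1.ofReal, h.2.ofReal⟩

/-- The fundamental theorem of calculus for complex valued absolutely continuous functions. -/
theorem integral_eq_sub_of_absolutelyContinuous {f f' : ℝ → ℂ} {a b : ℝ} (hab : a ≤ b)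
    (hf : AbsolutelyContinuousOnInterval f a b)
    (h : ∀ᵐ x : ℝ, x ∈ Ioo a b → HasDerivAt f (f' x) x) :
    ∫ x in a..b, f' x = f b - f a := by
  have hre : AbsolutelyContinuousOnInterval (fun x => (f x).re) a b :=
    absolutelyContinuousOnInterval_of_dist_le hf fun s t => by
      rw [Real.dist_eq, dist_eq_norm, ← Complex.sub_re]; exact Complex.abs_re_le_norm _
  have him : AbsolutelyContinuousOnInterval (fun x => (f x).im) a b :=
    absolutelyContinuousOnInterval_of_dist_le hf fun s t => by
      rw [Real.dist_eq, dist_eq_norm, ← Complex.sub_im]; exact Complex.abs_im_le_norm _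
  have hb : ∀ᵐ x : ℝ, x ≠ b := by simp [ae_iff, measure_singleton]
  have e : ∫ x in a..b, f' x = ∫ x in a..b,
      (((deriv (fun x => (f x).re) x : ℝ) : ℂ)
        + ((deriv (fun x => (f x).im) x : ℝ) : ℂ) * Complex.I) := by
    apply intervalIntegral.integral_congr_ae
    filter_upwards [h, hb] with x hx hxb hxI
    rw [uIoc_of_le hab] at hxI
    have hd := hx ⟨hxI.1, lt_of_le_of_ne hxI.2 hxb⟩
    have h1 : HasDerivAt (fun x => (f x).re) (f' x).re x :=
      (Complex.reCLM.hasFDerivAt.comp_hasDerivAt x hd)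
    have h2 : HasDerivAt (fun x => (f x).im) (f' x).im x :=
      (Complex.imCLM.hasFDerivAt.comp_hasDerivAt x hd)
    rw [h1.deriv, h2.deriv, Complex.re_add_im]
  rw [e, intervalIntegral.integral_add
      (intervalIntegrable_ofReal hre.intervalIntegrable_deriv)
      ((intervalIntegrable_ofReal him.intervalIntegrable_deriv).mul_const _),
    intervalIntegral.integral_mul_const, intervalIntegral.integral_ofReal,
    intervalIntegral.integral_ofReal, hre.integral_deriv_eq_sub, him.integral_deriv_eq_sub]
  apply Complex.ext <;> simp

/-! ### The entire function sin(ρt)/ρ and product formulas -/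

/-- The function `sin(ρt)/ρ`, equal to `t` at `ρ = 0`. -/
noncomputable def sinDiv (ρ : ℂ) (t : ℝ) : ℂ := ∫ τ in (0 : ℝ)..t, Complex.cos (ρ * τ)

theorem continuous_sinDiv : Continuous fun p : ℂ × ℝ => sinDiv p.1 p.2 := by
  unfold sinDiv
  exact intervalIntegral.continuous_parametric_primitive_of_continuous
    (f := fun (ρ : ℂ) (τ : ℝ) => Complex.cos (ρ * τ)) (by fun_prop)

@[fun_prop]
theorem Continuous.sinDiv {X : Type*} [TopologicalSpace X] {f : X → ℂ} {g : X → ℝ}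
    (hf : Continuous f) (hg : Continuous g) : Continuous fun x => sinDiv (f x) (g x) :=
  continuous_sinDiv.comp (hf.prodMk hg)

theorem hasDerivAt_sinDiv (ρ : ℂ) (t : ℝ) :
    HasDerivAt (sinDiv ρ) (Complex.cos (ρ * t)) t := by
  have hc : Continuous fun τ : ℝ => Complex.cos (ρ * τ) := by fun_prop
  exact intervalIntegral.integral_hasDerivAt_right (hc.intervalIntegrable _ _)
    (hc.stronglyMeasurableAtFilter _ _) hc.continuousAt

theorem hasDerivAt_cos_mul (ρ : ℂ) (t : ℝ) :
    HasDerivAt (fun t : ℝ => Complex.cos (ρ * t)) (-ρ * Complex.sin (ρ * t)) t := by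
  have h := (((hasDerivAt_id (t : ℂ)).const_mul ρ).ccos).comp_ofReal
  convert! h using 1
  simp; ring

theorem hasDerivAt_sin_mul (ρ : ℂ) (t : ℝ) :
    HasDerivAt (fun t : ℝ => Complex.sin (ρ * t)) (ρ * Complex.cos (ρ * t)) t := by
  have h := (((hasDerivAt_id (t : ℂ)).const_mul ρ).csin).comp_ofReal
  convert! h using 1
  simp; ring

@[simp] theorem sinDiv_zero_right (ρ : ℂ) : sinDiv ρ 0 = 0 := by simp [sinDiv]

@[simp] theorem sinDiv_zero_left (t : ℝ) : sinDiv 0 t = t := by simp [sinDiv]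

theorem mul_sinDiv (ρ : ℂ) (t : ℝ) : ρ * sinDiv ρ t = Complex.sin (ρ * t) := by
  have hc : Continuous fun τ : ℝ => ρ * Complex.cos (ρ * τ) := by fun_prop
  rw [sinDiv, ← intervalIntegral.integral_const_mul,
    intervalIntegral.integral_eq_sub_of_hasDerivAt (fun τ _ => hasDerivAt_sin_mul ρ τ)
      (hc.intervalIntegrable _ _)]
  simp

theorem sinDiv_eq {ρ : ℂ} (h : ρ ≠ 0) (t : ℝ) : sinDiv ρ t = Complex.sin (ρ * t) / ρ := by
  rw [← mul_sinDiv, mul_div_cancel_left₀ _ h]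

theorem sinDiv_neg (ρ : ℂ) (t : ℝ) : sinDiv ρ (-t) = -sinDiv ρ t := by
  rcases eq_or_ne ρ 0 with rfl | h
  · simp
  · simp [sinDiv_eq h, neg_div]

theorem sinDiv_mul_cos (ρ : ℂ) (s t : ℝ) :
    sinDiv ρ s * Complex.cos (ρ * t) = (sinDiv ρ (s + t) + sinDiv ρ (s - t)) / 2 := by
  rcases eq_or_ne ρ 0 with rfl | h
  · simp
  · simp only [sinDiv_eq h]
    push_cast
    rw [mul_add, mul_sub, Complex.sin_add, Complex.sin_sub]
    field_simp
    ring

theorem cos_mul_cos (ρ : ℂ) (s t : ℝ) :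
    Complex.cos (ρ * s) * Complex.cos (ρ * t) =
      (Complex.cos (ρ * (s + t : ℝ)) + Complex.cos (ρ * (s - t : ℝ))) / 2 := by
  push_cast
  rw [mul_add, mul_sub, Complex.cos_add, Complex.cos_sub]
  ring

theorem integral_cos_mul (ρ : ℂ) (a b : ℝ) :
    ∫ τ in a..b, Complex.cos (ρ * τ) = sinDiv ρ b - sinDiv ρ a := by
  have hc : Continuous fun τ : ℝ => Complex.cos (ρ * τ) := by fun_prop
  exact intervalIntegral.integral_eq_sub_of_hasDerivAt (fun τ _ => hasDerivAt_sinDiv ρ τ)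
      (hc.intervalIntegrable _ _)

/-- This is d'Alembert's formula for velocity data cos ρt. It converts the Volterra kernel
sin(ρ(s-r))/ρ into an integral over a section of the backward characteristic triangle, where ρ no
longer appears explicitly. -/
theorem sinDiv_mul_cos_eq_integral (ρ : ℂ) (s t : ℝ) :
    sinDiv ρ s * Complex.cos (ρ * t) = (∫ τ in (t - s)..(t + s), Complex.cos (ρ * τ)) / 2 := by
  rw [integral_cos_mul, sinDiv_mul_cos, ← neg_sub s t, sinDiv_neg, add_comm t s, sub_neg_eq_add]

/-! ### Integral equations for a solution and its derivative -/

section Solution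

variable {L : ℝ} {q : ℝ → ℂ} {ρ a b : ℂ} {y : ℝ → ℂ}

theorem IsSolution.continuousOn (h : IsSolution L q ρ a b y) : ContinuousOn y (Icc 0 L) :=
  h.differentiableOn.continuousOn

theorem IsSolution.continuousOn_xDeriv (hL : 0 < L) (h : IsSolution L q ρ a b y) :
    ContinuousOn (xDeriv L y) (Icc 0 L) := by
  simpa [uIcc_of_le hL.le] using h.absolutelyContinuous.continuousOn

theorem IsSolution.absolutelyContinuous_self (hL : 0 < L) (h : IsSolution L q ρ a b y) :
    AbsolutelyContinuousOnInterval y 0 L := by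
  apply ContDiffOn.absolutelyContinuousOnInterval
  rw [uIcc_of_le hL.le]
  rw [contDiffOn_one_iff_derivWithin (uniqueDiffOn_Icc hL)]
  exact ⟨h.differentiableOn, h.continuousOn_xDeriv hL⟩

theorem IsSolution.hasDerivAt (h : IsSolution L q ρ a b y) {t : ℝ} (ht : t ∈ Ioo 0 L) :
    HasDerivAt y (xDeriv L y t) t :=
  ((h.differentiableOn t ⟨ht.1.le, ht.2.le⟩).hasDerivWithinAt).hasDerivAt
    (Icc_mem_nhds ht.1 ht.2)

/-- Variation of constants, for the product of a solution with two smooth multipliers. -/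
theorem IsSolution.integral_multiplier (hL : 0 < L) (h : IsSolution L q ρ a b y) {x : ℝ}
    (hx : x ∈ Ioc 0 L) {f g f' : ℝ → ℂ} (hf : ∀ t, HasDerivAt f (f' t) t)
    (hg : ∀ t, HasDerivAt g (ρ ^ 2 * f t) t) (hf' : ∀ t, f' t = -g t) (hc : ContDiff ℝ 1 f)
    (hd : ContDiff ℝ 1 g) :
    ∫ t in (0 : ℝ)..x, f t * (q t * y t) =
      (f x * xDeriv L y x + g x * y x) - (f 0 * b + g 0 * a) := by
  have hsub : uIcc 0 x ⊆ uIcc 0 L := by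
    rw [uIcc_of_le hx.1.le, uIcc_of_le hL.le]; exact Icc_subset_Icc_right hx.2
  have hy := (h.absolutelyContinuous_self hL).mono hsub
  have hz := h.absolutelyContinuous.mono hsub
  have hfa : AbsolutelyContinuousOnInterval f 0 x :=
    hc.contDiffOn.absolutelyContinuousOnInterval
  have hga : AbsolutelyContinuousOnInterval g 0 x :=
    hd.contDiffOn.absolutelyContinuousOnInterval
  -- The function f y' + g y is absolutely continuous, and f' = -g, g' = ρ² f reduce its derivative
  -- to f (y'' + ρ² y) = f q y.
  have hH := (hfa.fun_smul hz).fun_add (hga.fun_smul hy)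
  have := integral_eq_sub_of_absolutelyContinuous (f' := fun t => f t * (q t * y t)) hx.1.le hH ?_
  · rw [this, h.initial_value, h.initial_deriv]; simp
  filter_upwards [h.equation] with t ht htI
  have htL : t ∈ Ioo 0 L := ⟨htI.1, htI.2.trans_le hx.2⟩
  obtain ⟨y₂, h1, h2⟩ := ht htL
  have hy₂ : y₂ = q t * y t - ρ ^ 2 * y t := by linear_combination -h2
  have := ((hf t).fun_mul h1).fun_add ((hg t).fun_mul (h.hasDerivAt htL))
  simp only [smul_eq_mul]
  convert! this using 1
  rw [hf', hy₂]; ring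

theorem contDiff_one_of_hasDerivAt {f f' : ℝ → ℂ} (h : ∀ t, HasDerivAt f (f' t) t)
    (hc : Continuous f') : ContDiff ℝ 1 f :=
  contDiff_one_iff_deriv.2 ⟨fun t => (h t).differentiableAt, by
    rwa [show deriv f = f' from funext fun t => (h t).deriv]⟩

theorem IsSolution.eq_integral (hL : 0 < L) (h : IsSolution L q ρ a b y) {x : ℝ}
    (hx : x ∈ Icc 0 L) :
    y x = a * Complex.cos (ρ * x) + b * sinDiv ρ x +
      ∫ t in (0 : ℝ)..x, sinDiv ρ (x - t) * (q t * y t) := by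
  rcases hx.1.eq_or_lt with rfl | h0
  · simp [h.initial_value]
  -- The multipliers satisfy f(x) = 0 and g(x) = 1, so the boundary term at x is y(x).
  have hf : ∀ t, HasDerivAt (fun t => sinDiv ρ (x - t)) (-Complex.cos (ρ * (x - t : ℝ))) t :=
    fun t => (hasDerivAt_sinDiv ρ (x - t)).comp_const_sub x t
  have hg : ∀ t, HasDerivAt (fun t : ℝ => Complex.cos (ρ * (x - t : ℝ)))
      (ρ ^ 2 * sinDiv ρ (x - t)) t := fun t => by
    convert! (hasDerivAt_cos_mul ρ (x - t)).comp_const_sub x t using 1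
    rw [← mul_sinDiv]; ring
  rw [h.integral_multiplier hL ⟨h0, hx.2⟩ hf hg (fun _ => rfl)
    (contDiff_one_of_hasDerivAt hf (by fun_prop)) (contDiff_one_of_hasDerivAt hg (by fun_prop))]
  simp; ring

theorem IsSolution.xDeriv_eq_integral (hL : 0 < L) (h : IsSolution L q ρ a b y) {x : ℝ}
    (hx : x ∈ Ioc 0 L) :
    xDeriv L y x = -a * ρ * Complex.sin (ρ * x) + b * Complex.cos (ρ * x) +
      ∫ t in (0 : ℝ)..x, Complex.cos (ρ * (x - t : ℝ)) * (q t * y t) := by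
  -- Now f(x) = 1 and g(x) = 0, so the boundary term at x is y'(x).
  have hf : ∀ t, HasDerivAt (fun t : ℝ => Complex.cos (ρ * (x - t : ℝ)))
      (ρ * Complex.sin (ρ * (x - t : ℝ))) t := fun t => by
    convert! (hasDerivAt_cos_mul ρ (x - t)).comp_const_sub x t using 1
    ring
  have hg : ∀ t, HasDerivAt (fun t : ℝ => -(ρ * Complex.sin (ρ * (x - t : ℝ))))
      (ρ ^ 2 * Complex.cos (ρ * (x - t : ℝ))) t := fun t => by
    convert! ((hasDerivAt_sin_mul ρ (x - t)).comp_const_sub x t).const_mul (-ρ) using 1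
    · ext; ring
    · ring
  rw [h.integral_multiplier hL hx hf hg (fun _ => by ring)
    (contDiff_one_of_hasDerivAt hf (by fun_prop)) (contDiff_one_of_hasDerivAt hg (by fun_prop))]
  simp; ring

end Solution

/-! ### Cauchy–Schwarz and an exponential weight -/

theorem sq_integral_norm_mul_le {α : Type*} [MeasurableSpace α] {μ : Measure α} {f g : α → ℂ}
    (hf : MemLp f 2 μ) (hg : MemLp g 2 μ) :
    (∫ x, ‖f x‖ * ‖g x‖ ∂μ) ^ 2 ≤ (∫ x, ‖f x‖ ^ 2 ∂μ) * ∫ x, ‖g x‖ ^ 2 ∂μ := by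
  have h := integral_mul_norm_le_Lp_mul_Lq (μ := μ) (f := f) (g := g) (p := 2) (q := 2)
    ⟨by norm_num, by norm_num, by norm_num⟩ (by simpa using hf) (by simpa using hg)
  simp only [Real.rpow_two, ← Real.sqrt_eq_rpow] at h
  have h0 : 0 ≤ ∫ x, ‖f x‖ * ‖g x‖ ∂μ := integral_nonneg fun _ => by positivity
  calc _ ≤ (√(∫ x, ‖f x‖ ^ 2 ∂μ) * √(∫ x, ‖g x‖ ^ 2 ∂μ)) ^ 2 := by gcongr
    _ = _ := by
      rw [mul_pow, Real.sq_sqrt (integral_nonneg fun _ => by positivity),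
        Real.sq_sqrt (integral_nonneg fun _ => by positivity)]

theorem memLp_two_of_continuous {g : ℝ → ℂ} (hg : Continuous g) (a b : ℝ) :
    MemLp g 2 (volume.restrict (Ioc a b)) := by
  obtain ⟨C, hC⟩ := isCompact_Icc.exists_bound_of_continuousOn (hg.continuousOn (s := Icc a b))
  refine MemLp.of_bound hg.aestronglyMeasurable C ?_
  rw [ae_restrict_iff' measurableSet_Ioc]
  exact ae_of_all _ fun x hx => hC x (Ioc_subset_Icc_self hx)

theorem sq_intervalIntegral_norm_mul_le {f g : ℝ → ℂ} {a b : ℝ} (hab : a ≤ b)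
    (hf : MemLp f 2 (volume.restrict (Ioc a b))) (hg : Continuous g) :
    (∫ x in a..b, ‖f x‖ * ‖g x‖) ^ 2 ≤ (∫ x in a..b, ‖f x‖ ^ 2) * ∫ x in a..b, ‖g x‖ ^ 2 := by
  simp only [intervalIntegral.integral_of_le hab]
  exact sq_integral_norm_mul_le hf (memLp_two_of_continuous hg a b)

theorem integral_exp_two_mul_le {l s : ℝ} (hl : 0 < l) :
    ∫ r in (0 : ℝ)..s, Real.exp (l * r) ^ 2 ≤ Real.exp (l * s) ^ 2 / (2 * l) := by
  have h : ∀ r, HasDerivAt (fun r => Real.exp (l * r) ^ 2 / (2 * l)) (Real.exp (l * r) ^ 2) r := by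
    intro r
    convert! ((((hasDerivAt_id r).const_mul l).exp).fun_pow 2).div_const (2 * l) using 1
    simp; field_simp
  have hc : Continuous fun r => Real.exp (l * r) ^ 2 := by fun_prop
  rw [intervalIntegral.integral_eq_sub_of_hasDerivAt (fun r _ => h r)
    (hc.intervalIntegrable _ _)]
  have : 0 ≤ Real.exp (l * 0) ^ 2 / (2 * l) := by positivity
  linarith

theorem integral_norm_mono {P : ℝ → ℂ} (hP : Continuous P) {a b c d : ℝ} (hab : a ≤ b)
    (hca : c ≤ a) (hbd : b ≤ d) : ∫ τ in a..b, ‖P τ‖ ≤ ∫ τ in c..d, ‖P τ‖ :=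
  intervalIntegral.integral_mono_interval hca hab hbd (ae_of_all _ fun _ => norm_nonneg _)
    (hP.norm.intervalIntegrable _ _)

/-! ### A priori estimates for the wave equation in a characteristic triangle -/

/-- The integral of the two travelling waves and of a bounded perturbation over a section of the
characteristic triangle. -/
theorem norm_integral_wave_le {P w : ℝ → ℂ} (hP : Continuous P)
    {X r d t B : ℝ} (hr : 0 ≤ r) (hd : 0 ≤ d) (hdX : d ≤ X) (ht : |t| + d + r ≤ X) (hB0 : 0 ≤ B)
    (hB : ∀ τ, |τ| ≤ X - r → ‖w τ - (P (r + τ) + P (r - τ)) / 2‖ ≤ B) :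
    ‖∫ τ in (t - d)..(t + d), w τ‖ ≤ (∫ τ in (-X)..X, ‖P τ‖) + 2 * X * B := by
  have hle : t - d ≤ t + d := by linarith
  have ht' := abs_le.1 (le_refl |t|)
  have hi1 : Continuous fun τ => ‖P (r + τ)‖ / 2 := by fun_prop
  have hi2 : Continuous fun τ => ‖P (r - τ)‖ / 2 := by fun_prop
  have e1 : ∫ τ in (t - d)..(t + d), ‖P (r + τ)‖ ≤ ∫ τ in (-X)..X, ‖P τ‖ := by
    rw [intervalIntegral.integral_comp_add_left (fun τ => ‖P τ‖)]
    exact integral_norm_mono hP (by linarith) (by linarith) (by linarith)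
  have e2 : ∫ τ in (t - d)..(t + d), ‖P (r - τ)‖ ≤ ∫ τ in (-X)..X, ‖P τ‖ := by
    rw [intervalIntegral.integral_comp_sub_left (fun τ => ‖P τ‖)]
    exact integral_norm_mono hP (by linarith) (by linarith) (by linarith)
  calc ‖∫ τ in (t - d)..(t + d), w τ‖
      ≤ ∫ τ in (t - d)..(t + d), (‖P (r + τ)‖ / 2 + ‖P (r - τ)‖ / 2 + B) := by
        refine intervalIntegral.norm_integral_le_of_norm_le hle (ae_of_all _ fun τ hτ => ?_)
          (((hi1.add hi2).add continuous_const).intervalIntegrable _ _)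
        have h1 : |τ| ≤ X - r := abs_le.2 ⟨by linarith [hτ.1], by linarith [hτ.2]⟩
        calc ‖w τ‖ = ‖(P (r + τ) + P (r - τ)) / 2 + (w τ - (P (r + τ) + P (r - τ)) / 2)‖ := by
              congr 1; ring
          _ ≤ ‖(P (r + τ) + P (r - τ)) / 2‖ + B := (norm_add_le _ _).trans (by linarith [hB τ h1])
          _ ≤ _ := by
              rw [norm_div, Complex.norm_two]
              linarith [norm_add_le (P (r + τ)) (P (r - τ))]
    _ = (∫ τ in (t - d)..(t + d), ‖P (r + τ)‖) / 2 + (∫ τ in (t - d)..(t + d), ‖P (r - τ)‖) / 2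
          + 2 * d * B := by
        rw [intervalIntegral.integral_add ((hi1.fun_add hi2).intervalIntegrable _ _)
          (continuous_const.intervalIntegrable _ _),
          intervalIntegral.integral_add (hi1.intervalIntegrable _ _) (hi2.intervalIntegrable _ _),
          intervalIntegral.integral_div, intervalIntegral.integral_div,
          intervalIntegral.integral_const, smul_eq_mul]
        ring
    _ ≤ _ := by
        have : 2 * d * B ≤ 2 * X * B := by gcongr
        linarith

/-- `u` solves, on the triangle `|t| ≤ X - s`, the integral form of the wave equation
`u_ss - q(s) u = u_tt` with Cauchy data built from `P` on the line `s = 0`. -/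
def IsWave (q : ℝ → ℂ) (h : ℂ) (X : ℝ) (P : ℝ → ℂ) (u : ℝ → ℝ → ℂ) : Prop :=
  ∀ s t : ℝ, 0 ≤ s → |t| + s ≤ X →
    u s t = (P (s + t) + P (s - t)) / 2 + h / 2 * (∫ τ in (t - s)..(t + s), P τ) +
      ∫ r in (0 : ℝ)..s, q r * ((∫ τ in (t - (s - r))..(t + (s - r)), u r τ) / 2)

/-- A Gronwall argument with the weight exp(-l s): the deviation from the free wave is continuous,
so its weighted supremum M over the compact triangle is attained. The integral equation gives M ≤ K
A + M/2 with A the L¹ norm of P, and the M/2 is absorbed. Only integrals of P enter, so K does not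
depend on P or u. -/
theorem exists_wave_sub_bound {q : ℝ → ℂ} {X : ℝ} (hX : 0 < X)
    (hq : MemLp q 2 (volume.restrict (Ioc 0 X))) (h : ℂ) :
    ∃ K : ℝ, 0 ≤ K ∧ ∀ (P : ℝ → ℂ) (u : ℝ → ℝ → ℂ), Continuous P →
      Continuous (fun p : ℝ × ℝ => u p.1 p.2) → IsWave q h X P u →
      ∀ s t : ℝ, 0 ≤ s → |t| + s ≤ X →
        ‖u s t - (P (s + t) + P (s - t)) / 2‖ ≤ K * ∫ τ in (-X)..X, ‖P τ‖ := by
  set Q₂ : ℝ := ∫ r in (0 : ℝ)..X, ‖q r‖ ^ 2 with hQ₂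
  set Q₁ : ℝ := ∫ r in (0 : ℝ)..X, ‖q r‖ with hQ₁
  have hQ₂0 : 0 ≤ Q₂ := intervalIntegral.integral_nonneg hX.le fun _ _ => by positivity
  have hQ₁0 : 0 ≤ Q₁ := intervalIntegral.integral_nonneg hX.le fun _ _ => by positivity
  -- With l ≥ 2X²Q₂, Cauchy–Schwarz bounds the weighted integral operator by 1/2; the summand 1
  -- keeps l positive.
  set l : ℝ := 2 * X ^ 2 * Q₂ + 1 with hl
  have hl0 : 0 < l := by positivity
  have hqi : IntervalIntegrable q volume 0 X := by
    rw [intervalIntegrable_iff_integrableOn_Ioc_of_le hX.le]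
    exact hq.integrable (by norm_num)
  have hsub : ∀ s, 0 ≤ s → s ≤ X → IntervalIntegrable q volume 0 s := fun s h0 h1 =>
    hqi.mono_set (by rw [uIcc_of_le h0, uIcc_of_le hX.le]; exact Icc_subset_Icc_right h1)
  have hweight : ∀ s, 0 ≤ s → s ≤ X →
      X * ∫ r in (0 : ℝ)..s, ‖q r‖ * Real.exp (l * r) ≤ Real.exp (l * s) / 2 := by
    intro s h0 h1
    have hsq := sq_intervalIntegral_norm_mul_le (g := fun r => (Real.exp (l * r) : ℂ)) h0
      (hq.mono_measure (Measure.restrict_mono (Ioc_subset_Ioc_right h1) le_rfl)) (by fun_prop)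
    simp only [Complex.norm_real, Real.norm_eq_abs, Real.abs_exp] at hsq
    have hm : ∫ r in (0 : ℝ)..s, ‖q r‖ ^ 2 ≤ Q₂ := by
      refine intervalIntegral.integral_mono_interval le_rfl h0 h1
        (ae_of_all _ fun _ => by positivity) ?_
      rw [intervalIntegrable_iff_integrableOn_Ioc_of_le hX.le]
      exact hq.integrable_norm_pow (by norm_num)
    have h3 := integral_exp_two_mul_le (s := s) hl0
    have h4 : (X * ∫ r in (0 : ℝ)..s, ‖q r‖ * Real.exp (l * r)) ^ 2 ≤
        (Real.exp (l * s) / 2) ^ 2 := by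
      calc _ = X ^ 2 * (∫ r in (0 : ℝ)..s, ‖q r‖ * Real.exp (l * r)) ^ 2 := by ring
        _ ≤ X ^ 2 * (Q₂ * (Real.exp (l * s) ^ 2 / (2 * l))) := by
          gcongr
          refine hsq.trans (mul_le_mul hm h3 ?_ hQ₂0)
          exact intervalIntegral.integral_nonneg h0 fun _ _ => by positivity
        _ = (2 * X ^ 2 * Q₂ / l) * (Real.exp (l * s) / 2) ^ 2 := by field_simp
        _ ≤ 1 * (Real.exp (l * s) / 2) ^ 2 := by
          gcongr
          rw [div_le_one hl0]; linarith
        _ = _ := one_mul _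
    exact le_of_sq_le_sq h4 (by positivity)
  set K : ℝ := (‖h‖ + Q₁) / 2 with hK
  refine ⟨2 * K * Real.exp (l * X), by positivity, fun P u hP hu hw => ?_⟩
  set A : ℝ := ∫ τ in (-X)..X, ‖P τ‖ with hA
  have hA0 : 0 ≤ A := intervalIntegral.integral_nonneg (by linarith) fun _ _ => by positivity
  set v : ℝ × ℝ → ℝ := fun p =>
    ‖u p.1 p.2 - (P (p.1 + p.2) + P (p.1 - p.2)) / 2‖ * Real.exp (-(l * p.1)) with hv
  have hvc : Continuous v := by
    have h1 : Continuous fun p : ℝ × ℝ => (P (p.1 + p.2) + P (p.1 - p.2)) / 2 := by fun_prop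
    have h2 : Continuous fun p : ℝ × ℝ => Real.exp (-(l * p.1)) := by fun_prop
    exact (hu.sub h1).norm.mul h2
  set D : Set (ℝ × ℝ) := {p | 0 ≤ p.1 ∧ |p.2| + p.1 ≤ X} with hD
  have hDc : IsCompact D := by
    refine Metric.isCompact_of_isClosed_isBounded ?_ ?_
    · exact (isClosed_le continuous_const continuous_fst).inter
        (isClosed_le (f := fun p : ℝ × ℝ => |p.2| + p.1) (by fun_prop) continuous_const)
    · refine (Metric.isBounded_Icc ((0 : ℝ), -X) (X, X)).subset fun p hp => ?_
      have := abs_le.1 (le_refl |p.2|)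
      have := abs_nonneg p.2
      exact ⟨⟨hp.1, by simp only; linarith [hp.1, hp.2]⟩,
        ⟨by simp only; linarith [hp.1, hp.2], by simp only; linarith [hp.1, hp.2]⟩⟩
  obtain ⟨p, hpD, hpmax⟩ := hDc.exists_isMaxOn ⟨(0, 0), by simp [hD, hX.le]⟩ hvc.continuousOn
  set M : ℝ := v p with hM
  have hM0 : 0 ≤ M := by positivity
  have hbound : ∀ s t : ℝ, 0 ≤ s → |t| + s ≤ X →
      ‖u s t - (P (s + t) + P (s - t)) / 2‖ ≤ M * Real.exp (l * s) := by
    intro s t h0 h1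
    have : v (s, t) ≤ M := hpmax (show (s, t) ∈ D from ⟨h0, h1⟩)
    simp only [hv, Real.exp_neg] at this
    rwa [← div_eq_mul_inv, div_le_iff₀ (Real.exp_pos _)] at this
  have hmain : ∀ s t : ℝ, 0 ≤ s → |t| + s ≤ X →
      ‖u s t - (P (s + t) + P (s - t)) / 2‖ ≤ K * A + M / 2 * Real.exp (l * s) := by
    intro s t h0 h1
    have hta := abs_nonneg t
    have ht' := abs_le.1 (le_refl |t|)
    have hsX : s ≤ X := by linarith
    have hqs := (hsub s h0 hsX).norm
    have hi : IntervalIntegrable (fun r => ‖q r‖ * (A / 2 + X * (M * Real.exp (l * r))))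
        volume 0 s := hqs.mul_continuousOn (by fun_prop)
    have hqe : IntervalIntegrable (fun r => ‖q r‖ * Real.exp (l * r)) volume 0 s :=
      hqs.mul_continuousOn (by fun_prop)
    have hint : ‖∫ r in (0 : ℝ)..s, q r * ((∫ τ in (t - (s - r))..(t + (s - r)), u r τ) / 2)‖ ≤
        ∫ r in (0 : ℝ)..s, ‖q r‖ * (A / 2 + X * (M * Real.exp (l * r))) := by
      refine intervalIntegral.norm_integral_le_of_norm_le h0 (ae_of_all _ fun r hr => ?_) hi
      rw [norm_mul, norm_div, Complex.norm_two]
      have := norm_integral_wave_le (w := u r) hP (X := X) (r := r) (d := s - r)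
        (t := t) (B := M * Real.exp (l * r)) hr.1.le (by linarith [hr.2]) (by linarith [hr.1])
        (by linarith) (by positivity) fun τ hτ => hbound r τ hr.1.le (by linarith)
      gcongr
      linarith
    have heq : ∫ r in (0 : ℝ)..s, ‖q r‖ * (A / 2 + X * (M * Real.exp (l * r))) =
        A / 2 * (∫ r in (0 : ℝ)..s, ‖q r‖) +
          M * (X * ∫ r in (0 : ℝ)..s, ‖q r‖ * Real.exp (l * r)) := by
      rw [← intervalIntegral.integral_const_mul, ← intervalIntegral.integral_const_mul,
        ← intervalIntegral.integral_const_mul, ← intervalIntegral.integral_add]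
      · congr 1; ext r; ring
      · exact hqs.const_mul _
      · exact (hqe.const_mul _).const_mul _
    have hq1 : ∫ r in (0 : ℝ)..s, ‖q r‖ ≤ Q₁ :=
      intervalIntegral.integral_mono_interval le_rfl h0 hsX (ae_of_all _ fun _ => by positivity)
        hqi.norm
    have hP1 : ‖∫ τ in (t - s)..(t + s), P τ‖ ≤ A :=
      (intervalIntegral.norm_integral_le_integral_norm (by linarith)).trans
        (integral_norm_mono hP (by linarith) (by linarith) (by linarith))
    have hws := hweight s h0 hsX
    rw [heq] at hint
    have e : u s t - (P (s + t) + P (s - t)) / 2 = h / 2 * (∫ τ in (t - s)..(t + s), P τ) +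
      ∫ r in (0 : ℝ)..s, q r * ((∫ τ in (t - (s - r))..(t + (s - r)), u r τ) / 2) := by
      rw [hw s t h0 h1]; ring
    rw [e]
    refine (norm_add_le _ _).trans ?_
    rw [norm_mul, norm_div, Complex.norm_two]
    have m1 : ‖h‖ / 2 * ‖∫ τ in (t - s)..(t + s), P τ‖ ≤ ‖h‖ / 2 * A := by gcongr
    have m2 : A / 2 * (∫ r in (0 : ℝ)..s, ‖q r‖) ≤ A / 2 * Q₁ := by gcongr
    have m3 := mul_le_mul_of_nonneg_left hws hM0
    rw [hK]
    linarith
  have hMle : M ≤ 2 * K * A := by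
    -- At the maximum point the bound reads M ≤ K A + M/2 after multiplication by the weight, which
    -- is at most 1.
    have h1 := hmain p.1 p.2 hpD.1 hpD.2
    have h2 : M ≤ (K * A + M / 2 * Real.exp (l * p.1)) * Real.exp (-(l * p.1)) := by
      simp only [hM, hv]; gcongr
    have h3 : Real.exp (l * p.1) * Real.exp (-(l * p.1)) = 1 := by
      rw [← Real.exp_add]; simp
    have h4 : Real.exp (-(l * p.1)) ≤ 1 := Real.exp_le_one_iff.2 (by
      have := mul_nonneg hl0.le hpD.1; linarith)
    have h5 : K * A * Real.exp (-(l * p.1)) ≤ K * A := mul_le_of_le_one_right (by positivity) h4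
    have h6 : (K * A + M / 2 * Real.exp (l * p.1)) * Real.exp (-(l * p.1)) =
      K * A * Real.exp (-(l * p.1)) + M / 2 * (Real.exp (l * p.1) * Real.exp (-(l * p.1))) := by
      ring
    rw [h6, h3] at h2
    linarith
  intro s t h0 h1
  have hsX : s ≤ X := by linarith [abs_nonneg t]
  calc _ ≤ M * Real.exp (l * s) := hbound s t h0 h1
    _ ≤ 2 * K * A * Real.exp (l * X) := by gcongr
    _ = _ := by ring

/-- The trace on the characteristic through `(X, 0)` of a solution of the wave equation is
controlled by the `L²` norm of its data. -/
theorem exists_wave_trace_bound {q : ℝ → ℂ} {X : ℝ} (hX : 0 < X)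
    (hq : MemLp q 2 (volume.restrict (Ioc 0 X))) (h : ℂ) :
    ∃ C : ℝ, 0 ≤ C ∧ ∀ (P : ℝ → ℂ) (u : ℝ → ℝ → ℂ), Continuous P →
      Continuous (fun p : ℝ × ℝ => u p.1 p.2) → IsWave q h X P u →
      ‖∫ s in (0 : ℝ)..X, q s * (u s (X - s) - P X / 2)‖ ^ 2 ≤
        C * ∫ τ in (-X)..X, ‖P τ‖ ^ 2 := by
  obtain ⟨K, hK0, hK⟩ := exists_wave_sub_bound hX hq h
  set Q₂ : ℝ := ∫ r in (0 : ℝ)..X, ‖q r‖ ^ 2 with hQ₂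
  set Q₁ : ℝ := ∫ r in (0 : ℝ)..X, ‖q r‖ with hQ₁
  have hQ₂0 : 0 ≤ Q₂ := intervalIntegral.integral_nonneg hX.le fun _ _ => by positivity
  have hqi : IntervalIntegrable q volume 0 X := by
    rw [intervalIntegrable_iff_integrableOn_Ioc_of_le hX.le]
    exact hq.integrable (by norm_num)
  refine ⟨2 * (Q₂ / 8 + (Q₁ * K) ^ 2 * (2 * X)), by positivity, fun P u hP hu hw => ?_⟩
  set A : ℝ := ∫ τ in (-X)..X, ‖P τ‖ with hA
  set N : ℝ := ∫ τ in (-X)..X, ‖P τ‖ ^ 2 with hN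
  have hA2 : A ^ 2 ≤ 2 * X * N := by
    have := sq_intervalIntegral_norm_mul_le (f := fun _ => 1) (g := P) (a := -X) (b := X)
      (by linarith) (memLp_two_of_continuous continuous_const _ _) hP
    simp only [norm_one, one_mul, one_pow, intervalIntegral.integral_const, smul_eq_mul,
      mul_one] at this
    linarith
  -- As s runs over (0, X), 2s - X runs over (-X, X) at double speed.
  have hshift : ∫ s in (0 : ℝ)..X, ‖P (2 * s - X)‖ ^ 2 = N / 2 := by
    have := intervalIntegral.integral_comp_mul_sub (a := 0) (b := X) (fun τ => ‖P τ‖ ^ 2)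
      (two_ne_zero) X
    rw [this, smul_eq_mul, hN]
    ring_nf
  have hcs := sq_intervalIntegral_norm_mul_le (g := fun s => P (2 * s - X)) hX.le hq
    (by fun_prop)
  rw [hshift] at hcs
  have hi : IntervalIntegrable (fun s => ‖q s‖ * (‖P (2 * s - X)‖ / 2 + K * A)) volume 0 X :=
    hqi.norm.mul_continuousOn (by fun_prop)
  have hi1 : IntervalIntegrable (fun s => ‖q s‖ * ‖P (2 * s - X)‖) volume 0 X :=
    hqi.norm.mul_continuousOn (by fun_prop)
  have hint : ‖∫ s in (0 : ℝ)..X, q s * (u s (X - s) - P X / 2)‖ ≤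
      ∫ s in (0 : ℝ)..X, ‖q s‖ * (‖P (2 * s - X)‖ / 2 + K * A) := by
    refine intervalIntegral.norm_integral_le_of_norm_le hX.le (ae_of_all _ fun s hs => ?_) hi
    rw [norm_mul]
    gcongr
    -- On the characteristic t = X - s the free wave is (P(X) + P(2s-X))/2, so removing P(X)/2
    -- leaves only the reflected wave.
    have h1 := hK P u hP hu hw s (X - s) hs.1.le (by
      rw [abs_of_nonneg (by linarith [hs.2])]; linarith)
    rw [show s + (X - s) = X by ring, show s - (X - s) = 2 * s - X by ring] at h1
    calc ‖u s (X - s) - P X / 2‖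
        = ‖P (2 * s - X) / 2 + (u s (X - s) - (P X + P (2 * s - X)) / 2)‖ := by congr 1; ring
      _ ≤ _ := (norm_add_le _ _).trans (by rw [norm_div, Complex.norm_two]; linarith)
  have heq : ∫ s in (0 : ℝ)..X, ‖q s‖ * (‖P (2 * s - X)‖ / 2 + K * A) =
      (∫ s in (0 : ℝ)..X, ‖q s‖ * ‖P (2 * s - X)‖) / 2 + Q₁ * K * A := by
    rw [← intervalIntegral.integral_div, mul_assoc, hQ₁, ← intervalIntegral.integral_mul_const,
      ← intervalIntegral.integral_add]
    · congr 1; ext r; ring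
    · exact hi1.div_const _
    · exact hqi.norm.mul_const _
  rw [heq] at hint
  set J := ∫ s in (0 : ℝ)..X, ‖q s‖ * ‖P (2 * s - X)‖
  calc _ ≤ (J / 2 + Q₁ * K * A) ^ 2 := by gcongr
    _ ≤ 2 * (J ^ 2 / 4 + (Q₁ * K) ^ 2 * A ^ 2) := by
      nlinarith [sq_nonneg (J / 2 - Q₁ * K * A)]
    _ ≤ 2 * (Q₂ * (N / 2) / 4 + (Q₁ * K) ^ 2 * (2 * X * N)) := by gcongr
    _ = _ := by ring

/-! ### L² boundedness of the remainders -/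

/-- A linear functional of the profiles `c ρ`, given by its values `F ρ`, which is bounded on their
linear span with respect to the norm of `L²(-X, X)`. -/
def IsL2Bounded (X : ℝ) (c : ℂ → ℝ → ℂ) (F : ℂ → ℂ) : Prop :=
  ∃ C : ℝ, 0 ≤ C ∧ ∀ (ι : Type) (A : Finset ι) (a ρ : ι → ℂ),
    ‖∑ i ∈ A, a i * F (ρ i)‖ ^ 2 ≤ C * ∫ τ in (-X)..X, ‖∑ i ∈ A, a i * c (ρ i) τ‖ ^ 2

/-- Multiplied by cos ρt, the Volterra equation becomes the integral wave equation, whose form does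
not involve ρ. Finite combinations over different ρ are therefore waves with the combined profile as
data, and the functional is exactly the trace controlled by `exists_wave_trace_bound`. -/
theorem isL2Bounded_of_volterra {q : ℝ → ℂ} {X : ℝ} (hX : 0 < X)
    (hq : MemLp q 2 (volume.restrict (Ioc 0 X))) (h : ℂ) {y y₀ c : ℂ → ℝ → ℂ}
    (hc : ∀ ρ, Continuous (c ρ)) (hyc : ∀ ρ, ContinuousOn (y ρ) (Icc 0 X))
    (hy : ∀ ρ, ∀ s ∈ Icc 0 X, y ρ s = y₀ ρ s +
      ∫ r in (0 : ℝ)..s, sinDiv ρ (s - r) * (q r * y ρ r))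
    (hy₀ : ∀ (ρ : ℂ) (s t : ℝ), y₀ ρ s * Complex.cos (ρ * t) =
      (c ρ (s + t) + c ρ (s - t)) / 2 + h / 2 * ∫ τ in (t - s)..(t + s), c ρ τ) :
    IsL2Bounded X c fun ρ =>
      ∫ s in (0 : ℝ)..X, q s * (y ρ s * Complex.cos (ρ * (X - s : ℝ)) - c ρ X / 2) := by
  obtain ⟨C, hC0, hC⟩ := exists_wave_trace_bound hX hq h
  refine ⟨C, hC0, fun ι A a ρ => ?_⟩
  -- The wave estimates ask for continuity on the whole plane, whereas y is continuous only on [0,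
  -- X]; it is extended by constants.
  set Y : ι → ℝ → ℂ := fun i => IccExtend hX.le ((Icc 0 X).domRestrict (y (ρ i))) with hY
  have hYc : ∀ i, Continuous (Y i) := fun i =>
    (continuousOn_iff_continuous_domRestrict.1 (hyc (ρ i))).Icc_extend'
  have hYe : ∀ i, ∀ s ∈ Icc 0 X, Y i s = y (ρ i) s := fun i s hs => by
    simp only [hY, IccExtend_of_mem _ _ hs, domRestrict_apply]
  have hqi : IntervalIntegrable q volume 0 X := by
    rw [intervalIntegrable_iff_integrableOn_Ioc_of_le hX.le]
    exact hq.integrable (by norm_num)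
  set P : ℝ → ℂ := fun τ => ∑ i ∈ A, a i * c (ρ i) τ with hP
  set u : ℝ → ℝ → ℂ := fun s t => ∑ i ∈ A, a i * (Y i s * Complex.cos (ρ i * t)) with hu
  have hPc : Continuous P := continuous_finsetSum _ fun i _ => continuous_const.mul (hc (ρ i))
  have huc : Continuous fun p : ℝ × ℝ => u p.1 p.2 := by
    refine continuous_finsetSum _ fun i _ => ?_
    have := hYc i
    fun_prop
  have hwave : IsWave q h X P u := by
    intro s t hs hst
    have hsX : s ≤ X := by linarith [abs_nonneg t]
    have hqs : IntervalIntegrable q volume 0 s :=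
      hqi.mono_set (by rw [uIcc_of_le hs, uIcc_of_le hX.le]; exact Icc_subset_Icc_right hsX)
    have hin : ∀ r, (∫ τ in (t - (s - r))..(t + (s - r)), u r τ) / 2 =
        ∑ i ∈ A, a i * (Y i r * (sinDiv (ρ i) (s - r) * Complex.cos (ρ i * t))) := by
      intro r
      simp only [hu]
      rw [intervalIntegral.integral_finsetSum, Finset.sum_div]
      · refine Finset.sum_congr rfl fun i _ => ?_
        rw [intervalIntegral.integral_const_mul, intervalIntegral.integral_const_mul,
          sinDiv_mul_cos_eq_integral]
        ring
      · exact fun i _ => Continuous.intervalIntegrable (by fun_prop) _ _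
    simp only [hin, hP]
    rw [intervalIntegral.integral_finsetSum (fun i _ => by
      exact Continuous.intervalIntegrable (continuous_const.mul (hc _)) _ _)]
    simp only [Finset.mul_sum]
    rw [intervalIntegral.integral_finsetSum, ← Finset.sum_add_distrib, Finset.sum_div,
      ← Finset.sum_add_distrib, ← Finset.sum_add_distrib]
    · refine Finset.sum_congr rfl fun i _ => ?_
      rw [intervalIntegral.integral_const_mul, hYe i s ⟨hs, hsX⟩, hy _ s ⟨hs, hsX⟩, add_mul,
        hy₀, ← intervalIntegral.integral_mul_const]
      have : ∫ r in (0 : ℝ)..s, q r * (a i * (Y i r * (sinDiv (ρ i) (s - r) *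
          Complex.cos (ρ i * t)))) = a i * ∫ r in (0 : ℝ)..s,
          sinDiv (ρ i) (s - r) * (q r * y (ρ i) r) * Complex.cos (ρ i * t) := by
        rw [← intervalIntegral.integral_const_mul]
        refine intervalIntegral.integral_congr fun r hr => ?_
        rw [uIcc_of_le hs] at hr
        simp only [hYe i r ⟨hr.1, hr.2.trans hsX⟩]
        ring
      rw [this]
      ring
    · intro i _
      have := hYc i
      exact hqs.mul_continuousOn (by fun_prop)
  convert hC P u hPc huc hwave using 3
  simp only [hu, hP, Finset.sum_div, ← Finset.sum_sub_distrib, Finset.mul_sum]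
  rw [intervalIntegral.integral_finsetSum]
  · refine Finset.sum_congr rfl fun i _ => ?_
    rw [← intervalIntegral.integral_const_mul]
    refine intervalIntegral.integral_congr fun r hr => ?_
    rw [uIcc_of_le hX.le] at hr
    simp only [hYe i r hr]
    ring
  · intro i _
    have := hYc i
    exact hqi.mul_continuousOn (by fun_prop)

section Solution

variable {L : ℝ} {q : ℝ → ℂ} {x : ℝ}

theorem memLp_restrict_Ioc (hq : MemLp q 2 (volume.restrict (Icc 0 L))) (hx : x ∈ Ioc 0 L) :
    MemLp q 2 (volume.restrict (Ioc 0 x)) :=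
  hq.mono_measure (Measure.restrict_mono
    (Ioc_subset_Icc_self.trans (Icc_subset_Icc_right hx.2)) le_rfl)

/-- The part of the derivative of a solution that the potential generates beyond `ω`. -/
theorem IsSolution.integral_sub_omega (hL : 0 < L)
    (hq : MemLp q 2 (volume.restrict (Icc 0 L))) (hx : x ∈ Ioc 0 L) {ρ a b : ℂ} {y : ℝ → ℂ}
    (h : IsSolution L q ρ a b y) (e : ℂ) :
    ∫ s in (0 : ℝ)..x, q s * (y s * Complex.cos (ρ * (x - s : ℝ)) - e / 2) =
      xDeriv L y x - (-a * ρ * Complex.sin (ρ * x) + b * Complex.cos (ρ * x)) -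
        omega q x * e := by
  have hqi : IntervalIntegrable q volume 0 x := by
    rw [intervalIntegrable_iff_integrableOn_Ioc_of_le hx.1.le]
    exact (memLp_restrict_Ioc hq hx).integrable (by norm_num)
  have hyc : ContinuousOn y (uIcc 0 x) := by
    rw [uIcc_of_le hx.1.le]; exact h.continuousOn.mono (Icc_subset_Icc_right hx.2)
  rw [h.xDeriv_eq_integral hL hx, omega]
  have : ∀ s, q s * (y s * Complex.cos (ρ * (x - s : ℝ)) - e / 2) =
      Complex.cos (ρ * (x - s : ℝ)) * (q s * y s) - q s * (e / 2) := fun s => by ring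
  simp only [this]
  rw [intervalIntegral.integral_sub, intervalIntegral.integral_mul_const]
  · ring
  · exact (hqi.mul_continuousOn hyc).continuousOn_mul (by fun_prop)
  · exact hqi.mul_const _

/-- Here the profile is the unperturbed solution sin(ρt)/ρ itself, an odd function of t, so the term
with h is absent. -/
theorem isL2Bounded_sine (hL : 0 < L) (hq : MemLp q 2 (volume.restrict (Icc 0 L)))
    (hx : x ∈ Ioc 0 L) {S : ℂ → ℝ → ℂ} (hS : ∀ ρ : ℂ, IsSolution L q ρ 0 1 (S ρ)) :
    IsL2Bounded x sinDiv fun ρ =>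
      xDeriv L (S ρ) x - Complex.cos (ρ * x) - omega q x * sinDiv ρ x := by
  have h := isL2Bounded_of_volterra hx.1 (memLp_restrict_Ioc hq hx) 0 (y := S) (y₀ := sinDiv)
    (c := sinDiv) (fun ρ => by fun_prop)
    (fun ρ => (hS ρ).continuousOn.mono (Icc_subset_Icc_right hx.2))
    (fun ρ s hs => by simpa using (hS ρ).eq_integral hL (Icc_subset_Icc_right hx.2 hs))
    (fun ρ s t => by rw [sinDiv_mul_cos]; ring)
  simpa [(hS _).integral_sub_omega hL hq hx, -Complex.ofReal_sub] using h

/-- The profile is cos ρt alone; the part h sin(ρs)/ρ of the unperturbed solution becomes the term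
(h/2) ∫ P of the wave equation. -/
theorem isL2Bounded_cosine (hL : 0 < L) (hq : MemLp q 2 (volume.restrict (Icc 0 L)))
    (hx : x ∈ Ioc 0 L) {h : ℂ} {φ : ℂ → ℝ → ℂ} (hφ : ∀ ρ : ℂ, IsSolution L q ρ 1 h (φ ρ)) :
    IsL2Bounded x (fun ρ t => Complex.cos (ρ * t)) fun ρ =>
      xDeriv L (φ ρ) x + ρ * Complex.sin (ρ * x) - (h + omega q x) * Complex.cos (ρ * x) := by
  have H := isL2Bounded_of_volterra hx.1 (memLp_restrict_Ioc hq hx) h (y := φ)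
    (y₀ := fun ρ s => Complex.cos (ρ * s) + h * sinDiv ρ s)
    (c := fun ρ t => Complex.cos (ρ * t)) (fun ρ => by fun_prop)
    (fun ρ => (hφ ρ).continuousOn.mono (Icc_subset_Icc_right hx.2))
    (fun ρ s hs => by simpa using (hφ ρ).eq_integral hL (Icc_subset_Icc_right hx.2 hs))
    (fun ρ s t => by
      rw [add_mul, cos_mul_cos, mul_assoc, sinDiv_mul_cos_eq_integral]; ring)
  simp only [(hφ _).integral_sub_omega hL hq hx] at H
  convert H using 2 with ρ
  ring

end Solution

/-! ### The sinc function as a Fourier coefficient -/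

theorem sinc_eq_sinDiv (z : ℂ) : sinc z = sinDiv (Real.pi * z) 1 := by
  rcases eq_or_ne z 0 with rfl | hz
  · simp [sinc]
  · have hp : (Real.pi : ℂ) ≠ 0 := Complex.ofReal_ne_zero.2 Real.pi_ne_zero
    rw [sinDiv_eq (mul_ne_zero hp hz), sinc, if_neg hz]
    simp

theorem continuous_sinc : Continuous sinc := by
  rw [show sinc = fun z => sinDiv (Real.pi * z) 1 from funext sinc_eq_sinDiv]
  fun_prop

theorem sinc_neg (z : ℂ) : sinc (-z) = sinc z := by
  simp [sinc]

@[simp] theorem sinc_zero : sinc 0 = 1 := by simp [sinc]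

theorem sinc_intCast {k : ℤ} (hk : k ≠ 0) : sinc k = 0 := by
  rw [sinc, if_neg (by exact_mod_cast hk), mul_comm, Complex.sin_int_mul_pi, zero_div]

/-- The `k`-th Fourier coefficient on `(-x, x)`. -/
noncomputable def symmCoeff (x : ℝ) (g : ℝ → ℂ) (k : ℤ) : ℂ :=
  (2 * x : ℂ)⁻¹ * ∫ t in (-x)..x, Complex.exp (-(Complex.I * (k * Real.pi / x) * t)) * g t

theorem symmCoeff_eq_fourierCoeffOn {x : ℝ} (hx : -x < x) (g : ℝ → ℂ) (k : ℤ) :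
    symmCoeff x g k = fourierCoeffOn hx g k := by
  rw [fourierCoeffOn_eq_integral, symmCoeff, Complex.real_smul]
  congr 1
  · push_cast; ring
  · refine intervalIntegral.integral_congr fun t _ => ?_
    simp only [smul_eq_mul, fourier_coe_apply]
    congr 2
    have : (x : ℂ) ≠ 0 := by
      have : x ≠ 0 := by rintro rfl; simp at hx
      exact_mod_cast this
    push_cast
    field_simp
    ring

theorem symmCoeff_sum {x : ℝ} {ι : Type*} (A : Finset ι) (a : ι → ℂ) {g : ι → ℝ → ℂ}
    (hg : ∀ i ∈ A, Continuous (g i)) (k : ℤ) :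
    symmCoeff x (fun t => ∑ i ∈ A, a i * g i t) k = ∑ i ∈ A, a i * symmCoeff x (g i) k := by
  simp only [symmCoeff, Finset.mul_sum]
  rw [intervalIntegral.integral_finsetSum, Finset.mul_sum]
  · refine Finset.sum_congr rfl fun i _ => ?_
    rw [mul_left_comm, ← intervalIntegral.integral_const_mul (a i)]
    congr 1
    exact intervalIntegral.integral_congr fun t _ => mul_left_comm _ _ _
  · intro i hi
    have := hg i hi
    exact Continuous.intervalIntegrable (by fun_prop) _ _

/-- Parseval's identity for finite linear combinations of continuous functions on `(-x, x)`. -/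
theorem hasSum_sq_symmCoeff {x : ℝ} (hx : 0 < x) {ι : Type*} (A : Finset ι) (a : ι → ℂ)
    {g : ι → ℝ → ℂ} (hg : ∀ i ∈ A, Continuous (g i)) :
    HasSum (fun k : ℤ => ‖∑ i ∈ A, a i * symmCoeff x (g i) k‖ ^ 2)
      ((2 * x)⁻¹ * ∫ t in (-x)..x, ‖∑ i ∈ A, a i * g i t‖ ^ 2) := by
  have hc : Continuous fun t => ∑ i ∈ A, a i * g i t :=
    continuous_finsetSum _ fun i hi => continuous_const.mul (hg i hi)
  have h := hasSum_sq_fourierCoeffOn (by linarith : -x < x) (memLp_two_of_continuous hc _ _)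
  simp only [← symmCoeff_eq_fourierCoeffOn, symmCoeff_sum A a hg, smul_eq_mul] at h
  convert h using 2
  ring

theorem symmCoeff_exp {x : ℝ} (hx : 0 < x) (σ : ℂ) (k : ℤ) :
    symmCoeff x (fun t => Complex.exp (Complex.I * σ * t)) k = sinc (σ * x / Real.pi - k) := by
  have hp : (Real.pi : ℂ) ≠ 0 := Complex.ofReal_ne_zero.2 Real.pi_ne_zero
  have hx' : (x : ℂ) ≠ 0 := Complex.ofReal_ne_zero.2 hx.ne'
  set z : ℂ := σ * x / Real.pi - k with hz
  have e : ∀ t : ℝ, Complex.exp (-(Complex.I * (k * Real.pi / x) * t)) *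
      Complex.exp (Complex.I * σ * t) = Complex.exp (Complex.I * (Real.pi * z / x) * t) := by
    intro t
    rw [← Complex.exp_add]
    congr 1
    rw [hz]
    field_simp
    ring
  simp only [symmCoeff, e]
  rcases eq_or_ne z 0 with h0 | h0
  · simp only [h0, mul_zero, zero_div, zero_mul, Complex.exp_zero, sinc_zero]
    rw [intervalIntegral.integral_const, Complex.real_smul]
    push_cast
    field_simp
    ring
  · have hne : Complex.I * (Real.pi * z / x) ≠ 0 :=
      mul_ne_zero Complex.I_ne_zero (div_ne_zero (mul_ne_zero hp h0) hx')
    rw [integral_exp_mul_complex hne, sinc, if_neg h0, Complex.sin]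
    push_cast
    have e1 : Complex.I * (Real.pi * z / x) * x = Real.pi * z * Complex.I := by
      field_simp
    have e2 : Complex.I * (Real.pi * z / x) * -x = -(Real.pi * z) * Complex.I := by
      field_simp
    rw [e1, e2]
    field_simp
    rw [Complex.I_sq]
    ring

theorem symmCoeff_cos {x : ℝ} (hx : 0 < x) (ρ : ℂ) (k : ℤ) :
    symmCoeff x (fun t => Complex.cos (ρ * t)) k =
      (sinc (ρ * x / Real.pi - k) + sinc (ρ * x / Real.pi + k)) / 2 := by
  have h := symmCoeff_sum (x := x) (Finset.univ : Finset Bool) (fun _ => 1 / 2)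
    (g := fun b t => Complex.exp (Complex.I * (if b then ρ else -ρ) * t))
    (fun b _ => by fun_prop) k
  simp only [Fintype.sum_bool, if_true, Bool.false_eq_true, if_false] at h
  rw [symmCoeff_exp hx, symmCoeff_exp hx] at h
  rw [show (fun t : ℝ => Complex.cos (ρ * t)) = fun t : ℝ =>
      1 / 2 * Complex.exp (Complex.I * ρ * t) + 1 / 2 * Complex.exp (Complex.I * -ρ * t) from by
    ext t
    rw [Complex.cos]
    ring_nf, h, ← sinc_neg (ρ * x / Real.pi + k)]
  ring_nf

/-- The cardinal functions of the half-integer sampling points. -/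
noncomputable def halfKernel (x : ℝ) (k : ℤ) (ρ : ℂ) : ℂ :=
  sinc (ρ * x / Real.pi - 1 / 2 - k) - sinc (ρ * x / Real.pi + 1 / 2 + k)

/-- The exponential factor shifts the frequencies by half a step, so that the coefficients sit at
half-integer nodes. The point ρ = 0 is excluded because there the quotient by ρ has the default
value 0 instead of its limit. -/
theorem symmCoeff_sinDiv {x : ℝ} (hx : 0 < x) {ρ : ℂ} (hρ : ρ ≠ 0) (k : ℤ) :
    symmCoeff x (fun t => Complex.exp (-(Complex.I * (Real.pi / (2 * x)) * t)) * sinDiv ρ t) k =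
      (2 * Complex.I)⁻¹ * (halfKernel x k ρ / ρ) := by
  have hp : (Real.pi : ℂ) ≠ 0 := Complex.ofReal_ne_zero.2 Real.pi_ne_zero
  have hx' : (x : ℂ) ≠ 0 := Complex.ofReal_ne_zero.2 hx.ne'
  have h := symmCoeff_sum (x := x) (Finset.univ : Finset Bool)
    (fun b => if b then (2 * Complex.I * ρ)⁻¹ else -(2 * Complex.I * ρ)⁻¹)
    (g := fun b t => Complex.exp (Complex.I *
      (if b then ρ - Real.pi / (2 * x) else -ρ - Real.pi / (2 * x)) * t))
    (fun b _ => by fun_prop) k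
  simp only [Fintype.sum_bool, if_true, Bool.false_eq_true, if_false] at h
  rw [symmCoeff_exp hx, symmCoeff_exp hx] at h
  rw [show (fun t : ℝ => Complex.exp (-(Complex.I * (Real.pi / (2 * x)) * t)) * sinDiv ρ t) =
      fun t : ℝ =>
      (2 * Complex.I * ρ)⁻¹ * Complex.exp (Complex.I * (ρ - Real.pi / (2 * x)) * t) +
      -(2 * Complex.I * ρ)⁻¹ * Complex.exp (Complex.I * (-ρ - Real.pi / (2 * x)) * t) from by
    ext t
    rw [sinDiv_eq hρ, Complex.sin,
      show Complex.I * (ρ - Real.pi / (2 * x)) * t =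
        -(Complex.I * (Real.pi / (2 * x)) * t) + ρ * t * Complex.I by ring,
      show Complex.I * (-ρ - Real.pi / (2 * x)) * t =
        -(Complex.I * (Real.pi / (2 * x)) * t) + -(ρ * t) * Complex.I by ring,
      Complex.exp_add, Complex.exp_add]
    field_simp
    rw [Complex.I_sq]
    ring, h, halfKernel, ← sinc_neg (ρ * x / Real.pi + 1 / 2 + k)]
  rw [show (ρ - Real.pi / (2 * x)) * x / Real.pi - k = ρ * x / Real.pi - 1 / 2 - k by
      field_simp,
    show (-ρ - Real.pi / (2 * x)) * x / Real.pi - k = -(ρ * x / Real.pi + 1 / 2 + k) by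
      field_simp; ring]
  field_simp
  ring

/-! ### Parseval equivalence for the two families of kernels -/

/-- The norm of `L²(-x, x)` on the span of the profiles `c ρ`, `ρ ∈ E`, is equivalent to the `ℓ²`
norm of the values of the kernels `W k`. -/
structure IsParsevalKernel (x : ℝ) (E : Set ℂ) (c : ℂ → ℝ → ℂ) (W : ℕ → ℂ → ℂ) : Prop where
  bound : ∀ (ι : Type) (A : Finset ι) (a ρ : ι → ℂ), (∀ i ∈ A, ρ i ∈ E) →
    ∃ m : ℝ, HasSum (fun k => ‖∑ i ∈ A, a i * W k (ρ i)‖ ^ 2) m ∧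
      ∫ t in (-x)..x, ‖∑ i ∈ A, a i * c (ρ i) t‖ ^ 2 ≤ x * m ∧
      x * m ≤ 2 * ∫ t in (-x)..x, ‖∑ i ∈ A, a i * c (ρ i) t‖ ^ 2

theorem isParsevalKernel_even {x : ℝ} (hx : 0 < x) :
    IsParsevalKernel x univ (fun ρ t => Complex.cos (ρ * t)) (evenKernel x) := by
  refine ⟨fun ι A a ρ _ => ?_⟩
  have h := hasSum_sq_symmCoeff hx A a (g := fun i t => Complex.cos (ρ i * t))
    (fun i _ => by fun_prop)
  simp only [symmCoeff_cos hx] at h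
  set N := ∫ t in (-x)..x, ‖∑ i ∈ A, a i * Complex.cos (ρ i * t)‖ ^ 2
  -- The coefficients are even in k. Folding ℤ onto ℕ counts k = 0 twice, which is why only an
  -- equivalence of norms, with ratio between 1 and 2, results.
  have h2 := h.nat_add_neg
  have e : ∀ k : ℕ, ‖∑ i ∈ A, a i * evenKernel x k (ρ i)‖ ^ 2 =
      2 * (‖∑ i ∈ A, a i * ((sinc (ρ i * x / Real.pi - (k : ℤ)) +
        sinc (ρ i * x / Real.pi + (k : ℤ))) / 2)‖ ^ 2 +
      ‖∑ i ∈ A, a i * ((sinc (ρ i * x / Real.pi - (-(k : ℤ) : ℤ)) +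
        sinc (ρ i * x / Real.pi + (-(k : ℤ) : ℤ))) / 2)‖ ^ 2) := by
    intro k
    push_cast
    simp only [sub_neg_eq_add, ← sub_eq_add_neg, ← mul_div_assoc, ← Finset.sum_div, norm_div,
      Complex.norm_two, evenKernel, div_pow]
    rw [show ∑ i ∈ A, a i * (sinc (ρ i * x / Real.pi + k) + sinc (ρ i * x / Real.pi - k)) =
      ∑ i ∈ A, a i * (sinc (ρ i * x / Real.pi - k) + sinc (ρ i * x / Real.pi + k)) from
      Finset.sum_congr rfl fun i _ => by ring]
    ring
  refine ⟨_, (h2.mul_left 2).congr_fun e, ?_, ?_⟩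
  · have : (0 : ℝ) ≤ ‖∑ i ∈ A, a i * ((sinc (ρ i * x / Real.pi - (0 : ℤ)) +
        sinc (ρ i * x / Real.pi + (0 : ℤ))) / 2)‖ ^ 2 := by positivity
    calc N = x * (2 * ((2 * x)⁻¹ * N)) := by field_simp
      _ ≤ _ := by gcongr; linarith
  · have := le_hasSum h 0 fun _ _ => by positivity
    calc _ ≤ x * (2 * ((2 * x)⁻¹ * N + (2 * x)⁻¹ * N)) := by gcongr
      _ = _ := by field_simp; ring

theorem isParsevalKernel_half {x : ℝ} (hx : 0 < x) :
    IsParsevalKernel x {0}ᶜ sinDiv (fun n ρ => halfKernel x n ρ / ρ) := by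
  refine ⟨fun ι A a ρ hρ => ?_⟩
  have h := hasSum_sq_symmCoeff hx A a
    (g := fun i t => Complex.exp (-(Complex.I * (Real.pi / (2 * x)) * t)) * sinDiv (ρ i) t)
    (fun i _ => by fun_prop)
  -- The half-frequency factor is unimodular and drops out of the norm.
  have hn : ∀ t : ℝ, ‖∑ i ∈ A, a i * (Complex.exp (-(Complex.I * (Real.pi / (2 * x)) * t)) *
      sinDiv (ρ i) t)‖ = ‖∑ i ∈ A, a i * sinDiv (ρ i) t‖ := by
    intro t
    simp only [mul_left_comm (a _), ← Finset.mul_sum, norm_mul]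
    rw [show -(Complex.I * (Real.pi / (2 * x)) * t) =
      ((-(Real.pi / (2 * x) * t) : ℝ) : ℂ) * Complex.I by push_cast; ring,
      Complex.norm_exp_ofReal_mul_I, one_mul]
  simp only [hn] at h
  set N := ∫ t in (-x)..x, ‖∑ i ∈ A, a i * sinDiv (ρ i) t‖ ^ 2
  have e1 : ∀ k : ℤ, ‖∑ i ∈ A, a i * symmCoeff x (fun t =>
      Complex.exp (-(Complex.I * (Real.pi / (2 * x)) * t)) * sinDiv (ρ i) t) k‖ ^ 2 =
      ‖∑ i ∈ A, a i * (halfKernel x k (ρ i) / ρ i)‖ ^ 2 / 4 := by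
    intro k
    rw [Finset.sum_congr rfl fun i hi => by rw [symmCoeff_sinDiv hx (hρ i hi)]]
    simp only [mul_left_comm (a _), ← Finset.mul_sum, norm_mul, mul_pow]
    simp
    ring
  simp only [e1] at h
  -- The half-integer kernels are odd under k ↦ -k-1, an involution without fixed points, so folding
  -- is exact here.
  have h2 := h.nat_add_neg_add_one
  have e : ∀ k : ℕ, ‖∑ i ∈ A, a i * (halfKernel x k (ρ i) / ρ i)‖ ^ 2 =
      2 * (‖∑ i ∈ A, a i * (halfKernel x (k : ℤ) (ρ i) / ρ i)‖ ^ 2 / 4 +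
        ‖∑ i ∈ A, a i * (halfKernel x (-((k : ℤ) + 1)) (ρ i) / ρ i)‖ ^ 2 / 4) := by
    intro k
    have : ∀ i, halfKernel x (-((k : ℤ) + 1)) (ρ i) = -halfKernel x k (ρ i) := by
      intro i
      simp only [halfKernel]
      push_cast
      ring_nf
    simp only [this, neg_div, mul_neg, Finset.sum_neg_distrib, norm_neg]
    ring
  refine ⟨_, (h2.mul_left 2).congr_fun e, le_of_eq ?_, ?_⟩
  · field_simp
  · have : 0 ≤ N := intervalIntegral.integral_nonneg (by linarith) fun _ _ => by positivity
    rw [show x * (2 * ((2 * x)⁻¹ * N)) = N by field_simp]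
    linarith

/-! ### Orthonormality of the translates of sinc in L²(ℝ) -/

/-- Bessel's identity for the integer translates of `sinc`. -/
theorem hasSum_sq_sum_sinc (t : ℝ) {ι : Type} (A : Finset ι) (a : ι → ℂ) (m : ι → ℤ)
    (hm : Set.InjOn m A) :
    HasSum (fun k : ℤ => ‖∑ i ∈ A, a i * sinc (t - m i - k)‖ ^ 2) (∑ i ∈ A, ‖a i‖ ^ 2) := by
  have hp : (Real.pi : ℂ) ≠ 0 := Complex.ofReal_ne_zero.2 Real.pi_ne_zero
  -- Changing t multiplies the underlying function by the unimodular e^{its}, so the sum does not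
  -- depend on t; it is evaluated at t = 0, where each sinc is 0 or 1.
  have key : ∀ t : ℝ, HasSum (fun k : ℤ => ‖∑ i ∈ A, a i * sinc (t - m i - k)‖ ^ 2)
      ((2 * Real.pi)⁻¹ * ∫ s in (-Real.pi)..Real.pi,
        ‖∑ i ∈ A, a i * Complex.exp (Complex.I * (-m i) * s)‖ ^ 2) := by
    intro t
    have h := hasSum_sq_symmCoeff Real.pi_pos A a
      (g := fun i s => Complex.exp (Complex.I * (t - m i) * s)) (fun i _ => by fun_prop)
    simp only [symmCoeff_exp Real.pi_pos, mul_div_cancel_right₀ _ hp] at h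
    convert h using 5 with s
    rw [← one_mul ‖∑ i ∈ A, a i * Complex.exp (Complex.I * (-m i) * s)‖,
      ← Complex.norm_exp_ofReal_mul_I (t * s), ← norm_mul, Finset.mul_sum]
    congr 1
    refine Finset.sum_congr rfl fun i _ => ?_
    rw [mul_left_comm, ← Complex.exp_add]
    push_cast
    ring_nf
  have h0 : HasSum (fun k : ℤ => ‖∑ i ∈ A, a i * sinc ((0 : ℝ) - m i - k)‖ ^ 2)
      (∑ i ∈ A, ‖a i‖ ^ 2) := by
    have hs : ∀ k : ℤ, ∀ i ∈ A, a i * sinc ((0 : ℝ) - m i - k) =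
        if k = -m i then a i else 0 := by
      intro k i _
      split_ifs with hk
      · simp [hk]
      · have : ((0 : ℝ) - m i - k : ℂ) = ((-m i - k : ℤ) : ℂ) := by push_cast; ring
        rw [this, sinc_intCast (by omega), mul_zero]
    have hsum : ∑ i ∈ A, ‖a i‖ ^ 2 = ∑ k ∈ A.image fun i => -m i,
        ‖∑ i ∈ A, a i * sinc ((0 : ℝ) - m i - k)‖ ^ 2 := by
      rw [Finset.sum_image fun i hi j hj hij => hm hi hj (neg_injective hij)]
      refine Finset.sum_congr rfl fun i hi => ?_
      rw [Finset.sum_congr rfl (hs _), Finset.sum_eq_single i]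
      · simp
      · intro j hj hji
        rw [if_neg]
        exact fun h => hji (hm hj hi (neg_injective h).symm)
      · exact fun h => (h hi).elim
    rw [hsum]
    refine hasSum_sum_of_ne_finset_zero fun k hk => ?_
    rw [Finset.sum_congr rfl (hs k), Finset.sum_eq_zero, norm_zero, zero_pow two_ne_zero]
    intro i hi
    rw [if_neg]
    rintro rfl
    exact hk (Finset.mem_image_of_mem _ hi)
  rw [h0.unique (key 0)]
  exact key t

theorem lintegral_eq_lintegral_tsum_translates {f : ℝ → ENNReal} (hf : Measurable f) :
    ∫⁻ t, f t = ∫⁻ t in Ioc (0 : ℝ) 1, ∑' k : ℤ, f (t + k) := by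
  have hm : ∀ k : ℤ, AEMeasurable (fun t : ℝ => f (t + k)) (volume.restrict (Ioc 0 1)) := fun k =>
    (hf.comp (measurable_id.add_const (k : ℝ))).aemeasurable
  rw [lintegral_tsum hm,
    ← setLIntegral_univ, ← iUnion_Ioc_intCast ℝ,
    lintegral_iUnion (fun _ => measurableSet_Ioc) (pairwise_disjoint_Ioc_intCast ℝ)]
  refine tsum_congr fun k => ?_
  have h := (measurePreserving_add_right volume (k : ℝ)).setLIntegral_comp_preimage
    (s := Ioc (k : ℝ) (k + 1)) measurableSet_Ioc hf
  rw [← h]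
  congr 2
  ext t
  simp

/-- The integer translates of `sinc` are orthonormal in `L²(ℝ)`. -/
theorem lintegral_sq_sum_sinc {ι : Type} (A : Finset ι) (a : ι → ℂ) (m : ι → ℤ)
    (hm : Set.InjOn m A) :
    ∫⁻ t : ℝ, ‖∑ i ∈ A, a i * sinc (t - m i)‖ₑ ^ 2 = ENNReal.ofReal (∑ i ∈ A, ‖a i‖ ^ 2) := by
  have hc : Continuous fun t : ℝ => ∑ i ∈ A, a i * sinc (t - m i) :=
    continuous_finsetSum _ fun i _ => continuous_const.mul (continuous_sinc.comp (by fun_prop))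
  have he : ∀ t : ℝ, ∑' k : ℤ, ‖∑ i ∈ A, a i * sinc ((t + k : ℝ) - m i)‖ₑ ^ 2 =
      ENNReal.ofReal (∑ i ∈ A, ‖a i‖ ^ 2) := by
    intro t
    have h := hasSum_sq_sum_sinc t A a m hm
    rw [← h.tsum_eq, ENNReal.ofReal_tsum_of_nonneg (fun _ => by positivity) h.summable,
      ← (Equiv.neg ℤ).tsum_eq]
    refine tsum_congr fun k => ?_
    rw [ENNReal.ofReal_pow (norm_nonneg _), ofReal_norm]
    simp only [Equiv.neg_apply]
    push_cast
    congr 3 with i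
    ring_nf
  rw [lintegral_eq_lintegral_tsum_translates (hc.measurable.enorm.pow_const 2)]
  simp only [he]
  simp

theorem lintegral_comp_mul_add {f : ℝ → ENNReal} (hf : Measurable f) {b : ℝ} (hb : 0 < b)
    (d : ℝ) : ∫⁻ t : ℝ, f (t * b + d) = ENNReal.ofReal b⁻¹ * ∫⁻ t, f t := by
  rw [← lintegral_add_right_eq_self f d,
    ← lintegral_map (μ := volume) (f := fun t => f (t + d)) (g := fun t => t * b)
      (hf.comp (measurable_id.add_const _)) (measurable_id.mul_const b),
    Real.map_volume_mul_right hb.ne', lintegral_smul_measure, abs_of_pos (inv_pos.2 hb),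
    smul_eq_mul]

/-! ### The abstract sampling theorem -/

section Sampling

variable {x : ℝ} {E : Set ℂ} {c : ℂ → ℝ → ℂ} {W : ℕ → ℂ → ℂ} {F : ℂ → ℂ}

theorem IsL2Bounded.exists_kernel_bound (hx : 0 < x) (hF : IsL2Bounded x c F)
    (hW : IsParsevalKernel x E c W) :
    ∃ C : ℝ, 0 ≤ C ∧ ∀ (ι : Type) (A : Finset ι) (a ρ : ι → ℂ), (∀ i ∈ A, ρ i ∈ E) →
      ∀ m : ℝ, HasSum (fun k => ‖∑ i ∈ A, a i * W k (ρ i)‖ ^ 2) m →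
        ‖∑ i ∈ A, a i * F (ρ i)‖ ^ 2 ≤ C * m := by
  obtain ⟨C, hC0, hC⟩ := hF
  refine ⟨C * x, by positivity, fun ι A a ρ hρ m hm => (hC ι A a ρ).trans ?_⟩
  obtain ⟨m', hm', h1, -⟩ := hW.bound ι A a ρ hρ
  rw [hm.unique hm', mul_assoc]
  gcongr

theorem IsParsevalKernel.summable_sq (hW : IsParsevalKernel x E c W) {ρ : ℂ} (hρ : ρ ∈ E) :
    Summable fun k => ‖W k ρ‖ ^ 2 := by
  obtain ⟨m, hm, -⟩ := hW.bound Unit Finset.univ (fun _ => 1) (fun _ => ρ) fun _ _ => hρ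
  simpa using hm.summable

theorem summable_norm_mul_of_sq {f w : ℕ → ℂ} (hf : Summable fun n => ‖f n‖ ^ 2)
    (hw : Summable fun n => ‖w n‖ ^ 2) : Summable fun n => ‖f n * w n‖ := by
  refine Summable.of_nonneg_of_le (fun _ => norm_nonneg _) (fun n => ?_) (hf.add hw)
  rw [norm_mul]
  nlinarith [sq_nonneg (‖f n‖ - ‖w n‖), sq_nonneg (‖f n‖), sq_nonneg (‖w n‖)]

variable {p d : ℕ → ℂ}

theorem sum_range_kernel_sample (hd : ∀ m, d m ≠ 0)
    (hWp : ∀ k m, W k (p m) = if k = m then d m else 0) (b : ℕ → ℂ) (N k : ℕ) :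
    ∑ m ∈ Finset.range N, b m / d m * W k (p m) = if k ∈ Finset.range N then b k else 0 := by
  simp only [hWp, mul_ite, mul_zero, Finset.sum_ite_eq]
  split_ifs with h
  · exact div_mul_cancel₀ _ (hd k)
  · rfl

/-- Duality: with fₖ = F(pₖ)/dₖ and coefficients conj(fₘ)/dₘ at the nodes, the functional takes the
value T = Σ |fₖ|², and the interpolation property makes the kernel norm equal to T as well. Hence T²
≤ C T and T ≤ C for every partial sum. -/
theorem summable_sq_samples (hx : 0 < x) (hF : IsL2Bounded x c F) (hW : IsParsevalKernel x E c W)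
    (hp : ∀ m, p m ∈ E) (hd : ∀ m, d m ≠ 0)
    (hWp : ∀ k m, W k (p m) = if k = m then d m else 0) :
    Summable fun k => ‖F (p k) / d k‖ ^ 2 := by
  obtain ⟨C, hC0, hC⟩ := hF.exists_kernel_bound hx hW
  refine summable_of_sum_range_le (c := C) (fun _ => by positivity) fun N => ?_
  set f : ℕ → ℂ := fun k => F (p k) / d k with hf
  set T : ℝ := ∑ k ∈ Finset.range N, ‖f k‖ ^ 2 with hT
  have hT0 : 0 ≤ T := Finset.sum_nonneg fun _ _ => by positivity
  have hs : HasSum (fun k => ‖∑ m ∈ Finset.range N, (starRingEnd ℂ) (f m) / d m * W k (p m)‖ ^ 2)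
      T := by
    simp only [sum_range_kernel_sample hd hWp]
    have : T = ∑ k ∈ Finset.range N,
        ‖if k ∈ Finset.range N then (starRingEnd ℂ) (f k) else 0‖ ^ 2 :=
      Finset.sum_congr rfl fun k hk => by rw [if_pos hk, RCLike.norm_conj]
    rw [this]
    exact hasSum_sum_of_ne_finset_zero fun k hk => by rw [if_neg hk]; simp
  have h := hC ℕ (Finset.range N) (fun m => (starRingEnd ℂ) (f m) / d m) p (fun m _ => hp m) T hs
  have he : ∑ m ∈ Finset.range N, (starRingEnd ℂ) (f m) / d m * F (p m) = (T : ℂ) := by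
    rw [hT]
    push_cast
    refine Finset.sum_congr rfl fun m _ => ?_
    rw [← Complex.conj_mul', hf]
    ring
  rw [he, Complex.norm_real, Real.norm_eq_abs, sq_abs] at h
  rcases hT0.eq_or_lt with h0 | h0
  · rwa [← h0]
  · rw [sq] at h
    exact le_of_mul_le_mul_right h h0

/-- The sampling theorem: a bounded functional is the sum of its cardinal series. -/
theorem hasSum_samples (hx : 0 < x) (hF : IsL2Bounded x c F) (hW : IsParsevalKernel x E c W)
    (hp : ∀ m, p m ∈ E) (hd : ∀ m, d m ≠ 0)
    (hWp : ∀ k m, W k (p m) = if k = m then d m else 0) {ρ : ℂ} (hρ : ρ ∈ E) :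
    HasSum (fun k => F (p k) / d k * W k ρ) (F ρ) := by
  obtain ⟨C, -, hC⟩ := hF.exists_kernel_bound hx hW
  have hsum : Summable fun k => F (p k) / d k * W k ρ :=
    (summable_norm_mul_of_sq (summable_sq_samples hx hF hW hp hd hWp)
      (hW.summable_sq hρ)).of_norm
  rw [hsum.hasSum_iff_tendsto_nat]
  set w : ℕ → ℝ := fun k => ‖W k ρ‖ ^ 2 with hw
  have hws : HasSum w (∑' k, w k) := (hW.summable_sq hρ).hasSum
  have hbound : ∀ N, ‖F ρ - ∑ k ∈ Finset.range N, F (p k) / d k * W k ρ‖ ^ 2 ≤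
      C * (∑' k, w k - ∑ k ∈ Finset.range N, w k) := by
    intro N
    -- `none` stands for ρ with weight 1 and `some m` for the node pₘ with weight -Wₘ(ρ)/dₘ.
    -- Interpolation cancels the kernel values with k < N and leaves the others intact, so the error
    -- is bounded by the tail of Σ |Wₖ(ρ)|².
    have h := hC (Option ℕ) (Finset.insertNone (Finset.range N))
      (fun o => o.elim 1 fun m => -(W m ρ / d m)) (fun o => o.elim ρ p)
      (fun o _ => by cases o <;> simp [hρ, hp]) (∑' k, w k - ∑ k ∈ Finset.range N, w k) ?_
    · simp only [Finset.sum_insertNone, Option.elim, one_mul] at h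
      convert h using 3
      rw [sub_eq_add_neg, ← Finset.sum_neg_distrib]
      congr 1
      exact Finset.sum_congr rfl fun k _ => by ring
    · simp only [Finset.sum_insertNone, Option.elim, one_mul, neg_mul, Finset.sum_neg_distrib,
        sum_range_kernel_sample hd hWp (fun m => W m ρ)]
      have h1 : HasSum (fun k => if k ∈ Finset.range N then w k else 0)
          (∑ k ∈ Finset.range N, w k) := by
        rw [show ∑ k ∈ Finset.range N, w k =
          ∑ k ∈ Finset.range N, if k ∈ Finset.range N then w k else 0 from
          Finset.sum_congr rfl fun k hk => by rw [if_pos hk]]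
        exact hasSum_sum_of_ne_finset_zero fun k hk => if_neg hk
      convert! hws.sub h1 using 2 with k
      split_ifs <;> simp [hw]
  have ht : Tendsto (fun N => C * (∑' k, w k - ∑ k ∈ Finset.range N, w k)) atTop (𝓝 0) := by
    simpa using (hws.tendsto_sum_nat.const_sub (∑' k, w k)).const_mul C
  rw [tendsto_iff_norm_sub_tendsto_zero]
  have h2 := squeeze_zero (fun _ => by positivity) hbound ht
  have h3 := h2.sqrt
  simpa [norm_sub_rev] using h3

end Sampling

/-! ### Convergence of series from Bessel inequalities -/

section Convergence

variable {f : ℕ → ℂ}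

theorem sum_Ico_le_tsum_sub {g : ℕ → ℝ} (hg : Summable g) (h0 : ∀ n, 0 ≤ g n) {N M : ℕ}
    (h : N ≤ M) : ∑ n ∈ Finset.Ico N M, g n ≤ ∑' n, g n - ∑ n ∈ Finset.range N, g n := by
  rw [Finset.sum_Ico_eq_sub _ h]
  have := hg.sum_le_tsum (Finset.range M) fun n _ => h0 n
  linarith

theorem summable_sq_of_sum_le {w : ℕ → ℂ} {B : ℝ} (h : ∀ s : Finset ℕ, ∑ n ∈ s, ‖w n‖ ^ 2 ≤ B) :
    Summable fun n => ‖w n‖ ^ 2 :=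
  summable_of_sum_le (fun _ => by positivity) h

theorem norm_tsum_sub_sum_sq_le (hf : Summable fun n => ‖f n‖ ^ 2) {w : ℕ → ℂ} {B : ℝ}
    (h : ∀ s : Finset ℕ, ∑ n ∈ s, ‖w n‖ ^ 2 ≤ B) (N : ℕ) :
    ‖∑' n, f n * w n - ∑ n ∈ Finset.range N, f n * w n‖ ^ 2 ≤
      (∑' n, ‖f n‖ ^ 2 - ∑ n ∈ Finset.range N, ‖f n‖ ^ 2) * B := by
  have hs := (summable_norm_mul_of_sq hf (summable_sq_of_sum_le h)).of_norm
  have ht := ((hs.hasSum.tendsto_sum_nat.sub_const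
    (∑ n ∈ Finset.range N, f n * w n)).norm.pow 2)
  refine le_of_tendsto ht ?_
  filter_upwards [eventually_ge_atTop N] with M hM
  rw [← Finset.sum_Ico_eq_sub _ hM]
  have h1 := sum_Ico_le_tsum_sub hf (fun _ => by positivity) hM
  calc _ ≤ (∑ n ∈ Finset.Ico N M, ‖f n‖ * ‖w n‖) ^ 2 := by
        gcongr
        exact norm_sum_le_of_le _ fun n _ => (norm_mul _ _).le
    _ ≤ (∑ n ∈ Finset.Ico N M, ‖f n‖ ^ 2) * ∑ n ∈ Finset.Ico N M, ‖w n‖ ^ 2 :=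
        Finset.sum_mul_sq_le_sq_mul_sq _ _ _
    _ ≤ _ := mul_le_mul h1 (h _) (Finset.sum_nonneg fun _ _ => by positivity)
        ((Finset.sum_nonneg fun _ _ => by positivity).trans h1)

theorem tendsto_tsum_sub_sum (hf : Summable fun n => ‖f n‖ ^ 2) :
    Tendsto (fun N => ∑' n, ‖f n‖ ^ 2 - ∑ n ∈ Finset.range N, ‖f n‖ ^ 2) atTop (𝓝 0) := by
  have h := hf.hasSum.tendsto_sum_nat.const_sub (∑' n, ‖f n‖ ^ 2)
  rwa [sub_self] at h

theorem tendstoUniformlyOn_of_bessel (hf : Summable fun n => ‖f n‖ ^ 2) {α : Type*}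
    {w : ℕ → α → ℂ} {A : Set α} {B : ℝ}
    (h : ∀ z ∈ A, ∀ s : Finset ℕ, ∑ n ∈ s, ‖w n z‖ ^ 2 ≤ B) :
    TendstoUniformlyOn (fun (N : ℕ) z => ∑ n ∈ Finset.range N, f n * w n z)
      (fun z => ∑' n, f n * w n z) atTop A := by
  rw [Metric.tendstoUniformlyOn_iff]
  intro ε hε
  have ht : Tendsto (fun N => (∑' n, ‖f n‖ ^ 2 - ∑ n ∈ Finset.range N, ‖f n‖ ^ 2) * B) atTop
      (𝓝 0) := by simpa using (tendsto_tsum_sub_sum hf).mul_const B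
  filter_upwards [ht.eventually_lt_const (show 0 < ε ^ 2 by positivity)] with N hN z hz
  rw [dist_eq_norm]
  exact lt_of_pow_lt_pow_left₀ 2 hε.le ((norm_tsum_sub_sum_sq_le hf (h z hz) N).trans_lt hN)

theorem eLpNorm_two_le {g : ℝ → ℂ} {K : ℝ} (h : ∫⁻ t, ‖g t‖ₑ ^ 2 ≤ ENNReal.ofReal K) :
    eLpNorm g 2 volume ≤ ENNReal.ofReal K ^ (1 / 2 : ℝ) := by
  rw [eLpNorm_eq_lintegral_rpow_enorm_toReal two_ne_zero ENNReal.ofNat_ne_top]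
  simp only [ENNReal.toReal_ofNat, ENNReal.rpow_two]
  gcongr

/-- The first Bessel bound, uniform in horizontal strips, gives absolute and uniform convergence by
Cauchy–Schwarz against the ℓ² tail of f. The second, on the real line, makes the partial sums Cauchy
in L²(ℝ). A compact set lies in a strip, and the real line is the strip with R = 0. -/
theorem cardinalConvergence_of_bessel {D : Set ℂ} {w : ℕ → ℂ → ℂ}
    (hf : Summable fun n => ‖f n‖ ^ 2)
    (hB : ∀ R : ℝ, ∃ B : ℝ, ∀ ρ ∈ D, |ρ.im| ≤ R → ∀ s : Finset ℕ, ∑ n ∈ s, ‖w n ρ‖ ^ 2 ≤ B)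
    (hL : ∃ B : ℝ, 0 ≤ B ∧ ∀ (s : Finset ℕ) (a : ℕ → ℂ),
      ∫⁻ t : ℝ, ‖∑ n ∈ s, a n * w n t‖ₑ ^ 2 ≤ ENNReal.ofReal (B * ∑ n ∈ s, ‖a n‖ ^ 2))
    (hm : ∀ n, Measurable fun t : ℝ => w n t) (hD : ∀ᵐ t : ℝ, (t : ℂ) ∈ D) :
    CardinalConvergence D fun n ρ => f n * w n ρ := by
  obtain ⟨B, hB0, hL⟩ := hL
  have habs : ∀ ρ ∈ D, Summable fun n => ‖f n * w n ρ‖ := fun ρ hρ => by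
    obtain ⟨B', hB'⟩ := hB |ρ.im|
    exact summable_norm_mul_of_sq hf (summable_sq_of_sum_le (hB' ρ hρ le_rfl))
  have hterm : ∀ n, Measurable fun t : ℝ => f n * w n t := fun n => (hm n).const_mul _
  have hpart : ∀ s : Finset ℕ, Measurable fun t : ℝ => ∑ n ∈ s, f n * w n t := fun s =>
    Finset.measurable_fun_sum _ fun n _ => hterm n
  have hlim : ∀ᵐ t : ℝ, Tendsto (fun M => ∑ n ∈ Finset.range M, f n * w n t) atTop
      (𝓝 (∑' n, f n * w n t)) := by
    filter_upwards [hD] with t ht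
    exact (habs t ht).of_norm.hasSum.tendsto_sum_nat
  have hmeas : AEStronglyMeasurable (fun t : ℝ => ∑' n, f n * w n t) volume :=
    aestronglyMeasurable_of_tendsto_ae atTop (fun M => (hpart (Finset.range M)).aestronglyMeasurable)
      hlim
  set T : ℕ → ℝ := fun N => ∑' n, ‖f n‖ ^ 2 - ∑ n ∈ Finset.range N, ‖f n‖ ^ 2 with hT
  have htail : ∀ N, eLpNorm (fun t : ℝ => ∑' n, f n * w n t -
      ∑ n ∈ Finset.range N, f n * w n t) 2 volume ≤ ENNReal.ofReal (B * T N) ^ (1 / 2 : ℝ) := by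
    intro N
    -- Fatou's lemma carries the bound for finite blocks from N to M over to the whole tail as M →
    -- ∞.
    refine (Lp.eLpNorm_lim_le_liminf_eLpNorm (f := fun M (t : ℝ) => ∑ n ∈ Finset.range M, f n * w n t -
      ∑ n ∈ Finset.range N, f n * w n t)
      (fun M => ((hpart (Finset.range M)).fun_sub (hpart (Finset.range N))).aestronglyMeasurable) _
      (hlim.mono fun t ht => ht.sub_const _)).trans ?_
    refine liminf_le_of_frequently_le' (Eventually.frequently ?_)
    filter_upwards [eventually_ge_atTop N] with M hM
    simp only [← Finset.sum_Ico_eq_sub _ hM]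
    refine (eLpNorm_two_le (hL _ f)).trans ?_
    gcongr
    exact sum_Ico_le_tsum_sub hf (fun _ => by positivity) hM
  have hroot : Tendsto (fun N => ENNReal.ofReal (B * T N) ^ (1 / 2 : ℝ)) atTop (𝓝 0) := by
    have h1 : Tendsto (fun N => ENNReal.ofReal (B * T N)) atTop (𝓝 0) := by
      simpa using ENNReal.tendsto_ofReal ((tendsto_tsum_sub_sum hf).const_mul B)
    simpa using h1.ennrpow_const (1 / 2 : ℝ)
  refine ⟨fun ρ hρ => (habs ρ hρ).of_norm, fun K hK => ?_, fun t ht => habs t ht, ?_,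
    fun n => ?_, ?_, tendsto_of_tendsto_of_tendsto_of_le_of_le tendsto_const_nhds hroot
      (fun _ => zero_le) htail⟩
  · obtain ⟨R, hR⟩ := hK.exists_bound_of_continuousOn Complex.continuous_im.continuousOn
    obtain ⟨B', hB'⟩ := hB R
    exact tendstoUniformlyOn_of_bessel hf fun ρ hρ => hB' ρ hρ.2 (hR ρ hρ.1)
  · obtain ⟨B', hB'⟩ := hB 0
    exact tendstoUniformlyOn_of_bessel (w := fun n (t : ℝ) => w n t) hf fun t ht =>
      hB' t ht (by simp)
  · refine ⟨(hterm n).aestronglyMeasurable, ?_⟩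
    have := eLpNorm_two_le (hL {n} f)
    simp only [Finset.sum_singleton] at this
    exact this.trans_lt (ENNReal.rpow_lt_top_of_nonneg (by norm_num) ENNReal.ofReal_ne_top)
  · refine ⟨hmeas, ?_⟩
    have := htail 0
    simp only [Finset.range_zero, Finset.sum_empty, sub_zero] at this
    exact this.trans_lt (ENNReal.rpow_lt_top_of_nonneg (by norm_num) ENNReal.ofReal_ne_top)

end Convergence

/-! ### Bounds in horizontal strips and on the real line -/

theorem norm_exp_I_mul_le {z : ℂ} {R M : ℝ} (hz : |z.im| ≤ R) {t : ℝ} (ht : |t| ≤ M) :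
    ‖Complex.exp (Complex.I * z * t)‖ ≤ Real.exp (R * M) := by
  rw [Complex.norm_exp]
  gcongr
  have : (Complex.I * z * t).re = -(z.im * t) := by simp
  rw [this]
  calc _ ≤ |z.im * t| := neg_le_abs _
    _ = |z.im| * |t| := abs_mul _ _
    _ ≤ _ := mul_le_mul hz ht (abs_nonneg _) ((abs_nonneg _).trans hz)

theorem norm_cos_mul_le {z : ℂ} {R M : ℝ} (hz : |z.im| ≤ R) {t : ℝ} (ht : |t| ≤ M) :
    ‖Complex.cos (z * t)‖ ≤ Real.exp (R * M) := by
  have h1 := norm_exp_I_mul_le hz ht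
  have h2 := norm_exp_I_mul_le (z := -z) (by simpa using hz) ht
  rw [Complex.cos, norm_div, Complex.norm_two]
  have h3 := norm_add_le (Complex.exp (z * t * Complex.I)) (Complex.exp (-(z * t) * Complex.I))
  rw [show z * t * Complex.I = Complex.I * z * t by ring,
    show -(z * t) * Complex.I = Complex.I * -z * t by ring] at *
  linarith

theorem norm_sinDiv_le {z : ℂ} {R M : ℝ} (hz : |z.im| ≤ R) {t : ℝ} (ht : |t| ≤ M) :
    ‖sinDiv z t‖ ≤ Real.exp (R * M) * M := by
  have h := intervalIntegral.norm_integral_le_of_norm_le_const (a := 0) (b := t)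
    (f := fun τ : ℝ => Complex.cos (z * τ)) (C := Real.exp (R * M)) fun τ hτ =>
    norm_cos_mul_le hz (by
      have := abs_sub_left_of_mem_uIcc (uIoc_subset_uIcc hτ)
      simp only [sub_zero] at this
      exact this.trans ht)
  rw [sub_zero] at h
  exact h.trans (by gcongr)

/-- The bound applied to the difference of two profiles controls F(ρ) - F(ρ₀) by their L² distance,
which tends to 0 as ρ → ρ₀. -/
theorem IsL2Bounded.continuous {x : ℝ} {c : ℂ → ℝ → ℂ} {F : ℂ → ℂ} (hF : IsL2Bounded x c F)
    (hc : Continuous fun p : ℂ × ℝ => c p.1 p.2) : Continuous F := by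
  obtain ⟨C, -, hC⟩ := hF
  rw [continuous_iff_continuousAt]
  intro ρ₀
  have hb : ∀ ρ, ‖F ρ - F ρ₀‖ ^ 2 ≤ C * ∫ τ in (-x)..x, ‖c ρ τ - c ρ₀ τ‖ ^ 2 := by
    intro ρ
    have := hC Bool Finset.univ (fun b => if b then 1 else -1) (fun b => if b then ρ else ρ₀)
    simpa [← sub_eq_add_neg] using this
  have ht : Continuous fun ρ => C * ∫ τ in (-x)..x, ‖c ρ τ - c ρ₀ τ‖ ^ 2 := by
    refine continuous_const.mul
      (intervalIntegral.continuous_parametric_intervalIntegral_of_continuous' ?_ _ _)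
    have h2 : Continuous fun p : ℂ × ℝ => c ρ₀ p.2 :=
      hc.comp (continuous_const.prodMk continuous_snd)
    exact (hc.sub h2).norm.pow 2
  have h0 := ht.tendsto ρ₀
  simp only [sub_self, norm_zero, ne_eq, OfNat.ofNat_ne_zero, not_false_eq_true, zero_pow,
    intervalIntegral.integral_zero, mul_zero] at h0
  have h1 := (squeeze_zero (fun _ => by positivity) hb h0).sqrt
  rw [ContinuousAt, tendsto_iff_norm_sub_tendsto_zero]
  simpa using h1

theorem IsParsevalKernel.sum_sq_le {x : ℝ} (hx : 0 < x) {E : Set ℂ} {c : ℂ → ℝ → ℂ}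
    {W : ℕ → ℂ → ℂ} (hW : IsParsevalKernel x E c W) {ρ : ℂ} (hρ : ρ ∈ E) {M : ℝ}
    (hM : ∀ t, |t| ≤ x → ‖c ρ t‖ ≤ M) (hc : Continuous (c ρ)) (s : Finset ℕ) :
    ∑ n ∈ s, ‖W n ρ‖ ^ 2 ≤ 4 * M ^ 2 := by
  obtain ⟨m, hm, -, h⟩ := hW.bound Unit Finset.univ (fun _ => 1) (fun _ => ρ) fun _ _ => hρ
  simp only [Finset.univ_unique, Finset.sum_singleton, one_mul] at hm h
  have h1 : ∫ t in (-x)..x, ‖c ρ t‖ ^ 2 ≤ ∫ t in (-x)..x, M ^ 2 := by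
    refine intervalIntegral.integral_mono_on (by linarith)
      ((hc.norm.pow 2).intervalIntegrable _ _) (continuous_const.intervalIntegrable _ _)
      fun t ht => ?_
    have := hM t (abs_le.2 ht)
    gcongr
  rw [intervalIntegral.integral_const, smul_eq_mul] at h1
  refine (sum_le_hasSum s (fun _ _ => by positivity) hm).trans ?_
  refine le_of_mul_le_mul_left ?_ hx
  linarith

/-- The sum of two `sinc` functions centred at opposite points. -/
noncomputable def pairKernel (e : ℂ) (d : ℝ) (n : ℕ) (z : ℂ) : ℂ :=
  sinc (z + d - n) + e * sinc (z - d + n)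

/-- The numbers sinc(z-k) are the Fourier coefficients of e^{izs} on (-π, π), a function bounded by
exp(Rπ) in the strip. -/
theorem sum_sq_sinc_le {z : ℂ} {R : ℝ} (hz : |z.im| ≤ R) (s : Finset ℤ) :
    ∑ k ∈ s, ‖sinc (z - k)‖ ^ 2 ≤ Real.exp (R * Real.pi) ^ 2 := by
  have hp : (Real.pi : ℂ) ≠ 0 := Complex.ofReal_ne_zero.2 Real.pi_ne_zero
  have h := hasSum_sq_symmCoeff Real.pi_pos (Finset.univ : Finset Unit) (fun _ => 1)
      (g := fun _ s => Complex.exp (Complex.I * z * s)) (fun i _ => by fun_prop)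
  simp only [symmCoeff_exp Real.pi_pos, mul_div_cancel_right₀ _ hp, Finset.univ_unique,
    Finset.sum_singleton, one_mul] at h
  refine (sum_le_hasSum s (fun _ _ => by positivity) h).trans ?_
  have h1 : ∫ t in (-Real.pi)..Real.pi, ‖Complex.exp (Complex.I * z * t)‖ ^ 2 ≤
      ∫ t in (-Real.pi)..Real.pi, Real.exp (R * Real.pi) ^ 2 := by
    refine intervalIntegral.integral_mono_on (by linarith [Real.pi_pos])
      (Continuous.intervalIntegrable (by fun_prop) _ _) (continuous_const.intervalIntegrable _ _)
      fun t ht => ?_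
    have := norm_exp_I_mul_le hz (abs_le.2 ht)
    gcongr
  rw [intervalIntegral.integral_const, smul_eq_mul] at h1
  rw [inv_mul_le_iff₀ (by positivity)]
  linarith

theorem sum_sq_pairKernel_le {e : ℂ} (he : ‖e‖ ≤ 1) (d : ℝ) {z : ℂ} {R : ℝ} (hz : |z.im| ≤ R)
    (s : Finset ℕ) : ∑ n ∈ s, ‖pairKernel e d n z‖ ^ 2 ≤ 4 * Real.exp (R * Real.pi) ^ 2 := by
  have h1 := sum_sq_sinc_le (z := z + d) (by simpa using hz) (s.map Nat.castEmbedding)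
  have h2 := sum_sq_sinc_le (z := z - d) (by simpa using hz)
    ((s.map Nat.castEmbedding).map (Equiv.neg ℤ).toEmbedding)
  simp only [Finset.sum_map, Nat.castEmbedding_apply, Int.cast_natCast, Equiv.coe_toEmbedding,
    Equiv.neg_apply, Int.cast_neg, sub_neg_eq_add] at h1 h2
  calc _ ≤ ∑ n ∈ s, (2 * ‖sinc (z + d - n)‖ ^ 2 + 2 * ‖sinc (z - d + n)‖ ^ 2) := by
        refine Finset.sum_le_sum fun n _ => ?_
        have h3 : ‖pairKernel e d n z‖ ≤ ‖sinc (z + d - n)‖ + ‖sinc (z - d + n)‖ := by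
          refine (norm_add_le _ _).trans ?_
          rw [norm_mul]
          gcongr
          exact mul_le_of_le_one_left (norm_nonneg _) he
        calc _ ≤ (‖sinc (z + d - n)‖ + ‖sinc (z - d + n)‖) ^ 2 := by gcongr
          _ ≤ _ := by nlinarith [sq_nonneg (‖sinc (z + d - n)‖ - ‖sinc (z - d + n)‖)]
    _ ≤ _ := by
        rw [Finset.sum_add_distrib, ← Finset.mul_sum, ← Finset.mul_sum]
        linarith

theorem enorm_add_sq_le (u v : ℂ) : ‖u + v‖ₑ ^ 2 ≤ 2 * ‖u‖ₑ ^ 2 + 2 * ‖v‖ₑ ^ 2 := by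
  simp only [← ofReal_norm]
  rw [← ENNReal.ofReal_pow (norm_nonneg _), ← ENNReal.ofReal_pow (norm_nonneg _),
    ← ENNReal.ofReal_pow (norm_nonneg _), show (2 : ENNReal) = ENNReal.ofReal 2 by simp,
    ← ENNReal.ofReal_mul zero_le_two, ← ENNReal.ofReal_mul zero_le_two,
    ← ENNReal.ofReal_add (by positivity) (by positivity)]
  apply ENNReal.ofReal_le_ofReal
  calc _ ≤ (‖u‖ + ‖v‖) ^ 2 := by gcongr; exact norm_add_le _ _
    _ ≤ _ := by nlinarith [sq_nonneg (‖u‖ - ‖v‖)]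

theorem lintegral_sq_sum_sinc_scaled {b : ℝ} (hb : 0 < b) (d : ℝ) (s : Finset ℕ) (a : ℕ → ℂ)
    (m : ℕ → ℤ) (hm : Function.Injective m) :
    ∫⁻ t : ℝ, ‖∑ n ∈ s, a n * sinc (t * b + d - m n)‖ₑ ^ 2 =
      ENNReal.ofReal (b⁻¹ * ∑ n ∈ s, ‖a n‖ ^ 2) := by
  have hc : Continuous fun t : ℝ => ∑ n ∈ s, a n * sinc (t - m n) :=
    continuous_finsetSum _ fun i _ => continuous_const.mul (continuous_sinc.comp (by fun_prop))
  have h := lintegral_comp_mul_add (f := fun t : ℝ => ‖∑ n ∈ s, a n * sinc (t - m n)‖ₑ ^ 2)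
    (hc.measurable.enorm.pow_const 2) hb d
  rw [lintegral_sq_sum_sinc s a m hm.injOn, ← ENNReal.ofReal_mul (by positivity)] at h
  rw [← h]
  push_cast
  rfl

theorem lintegral_sq_sum_pairKernel_le {e : ℂ} (he : ‖e‖ ≤ 1) (d : ℝ) {b : ℝ} (hb : 0 < b)
    (s : Finset ℕ) (a : ℕ → ℂ) :
    ∫⁻ t : ℝ, ‖∑ n ∈ s, a n * pairKernel e d n (t * b)‖ₑ ^ 2 ≤
      ENNReal.ofReal (4 * b⁻¹ * ∑ n ∈ s, ‖a n‖ ^ 2) := by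
  have h1 := lintegral_sq_sum_sinc_scaled hb d s a (fun n => (n : ℤ)) Nat.cast_injective
  have h2 := lintegral_sq_sum_sinc_scaled hb (-d) s a (fun n => -(n : ℤ))
    (neg_injective.comp Nat.cast_injective)
  have hc : Continuous fun t : ℝ => ∑ n ∈ s, a n * sinc (t * b + d - ((n : ℤ) : ℂ)) :=
    continuous_finsetSum _ fun i _ => continuous_const.mul (continuous_sinc.comp (by fun_prop))
  calc _ ≤ ∫⁻ t : ℝ, (2 * ‖∑ n ∈ s, a n * sinc (t * b + d - ((n : ℤ) : ℂ))‖ₑ ^ 2 +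
        2 * ‖∑ n ∈ s, a n * sinc (t * b + (-d : ℝ) - ((-(n : ℤ) : ℤ) : ℂ))‖ₑ ^ 2) := by
        refine lintegral_mono fun t => ?_
        have h3 : ∑ n ∈ s, a n * pairKernel e d n (t * b) =
            ∑ n ∈ s, a n * sinc (t * b + d - ((n : ℤ) : ℂ)) +
            e * ∑ n ∈ s, a n * sinc (t * b + (-d : ℝ) - ((-(n : ℤ) : ℤ) : ℂ)) := by
          rw [Finset.mul_sum, ← Finset.sum_add_distrib]
          refine Finset.sum_congr rfl fun n _ => ?_
          simp only [pairKernel]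
          push_cast
          ring_nf
        rw [h3]
        refine (enorm_add_sq_le _ _).trans ?_
        gcongr
        rw [enorm_mul]
        refine mul_le_of_le_one_left' ?_
        rw [← ofReal_norm]
        exact ENNReal.ofReal_le_one.2 he
    _ = _ := by
        rw [lintegral_add_left ((hc.measurable.enorm.pow_const 2).const_mul 2),
          lintegral_const_mul' _ _ ENNReal.ofNat_ne_top,
          lintegral_const_mul' _ _ ENNReal.ofNat_ne_top, h1, h2, ← two_mul, ← mul_assoc,
          show (2 * 2 : ENNReal) = ENNReal.ofReal 4 by norm_num,
          ← ENNReal.ofReal_mul (by norm_num), ← mul_assoc]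

/-! ### Identities for j₁ and bounds for the concrete kernels -/

/-- The elementary form of the spherical Bessel function of order one. -/
theorem mul_sphericalBesselJ_one (z : ℂ) :
    Real.pi * z * sphericalBesselJ 1 (Real.pi * z) = sinc z - Complex.cos (Real.pi * z) := by
  have hp : (Real.pi : ℂ) ≠ 0 := Complex.ofReal_ne_zero.2 Real.pi_ne_zero
  rcases eq_or_ne z 0 with rfl | hz
  · simp
  rw [sinc, if_neg hz]
  have hw : (Real.pi : ℂ) * z ≠ 0 := mul_ne_zero hp hz
  generalize (Real.pi : ℂ) * z = w at hw
  have h := ((Complex.hasSum_sin w).div_const w).sub (Complex.hasSum_cos w)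
  -- The constant terms of sin w / w and cos w cancel; the remaining terms, reindexed from 0, are
  -- those of w j₁(w).
  rw [← hasSum_nat_add_iff' 1] at h
  have hterm : ∀ k : ℕ,
      (-1) ^ (k + 1) * w ^ (2 * (k + 1) + 1) / ((2 * (k + 1) + 1).factorial : ℂ) / w -
      (-1) ^ (k + 1) * w ^ (2 * (k + 1)) / ((2 * (k + 1)).factorial : ℂ) =
      w * (w ^ 1 * ((-(w ^ 2 / 2)) ^ k / ((Nat.factorial k : ℂ) *
        (Nat.doubleFactorial (2 * 1 + 2 * k + 1) : ℂ)))) := by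
    intro k
    have e1 : ((2 * (k + 1) + 1).factorial : ℂ) = (2 * k + 3) * (2 * (k + 1)).factorial := by
      rw [Nat.factorial_succ]; push_cast; ring
    have e2 : (2 * (k + 1) + 1).factorial =
        Nat.doubleFactorial (2 * 1 + 2 * k + 1) * (2 ^ (k + 1) * (k + 1).factorial) := by
      rw [Nat.factorial_eq_mul_doubleFactorial, Nat.doubleFactorial_two_mul]
      ring_nf
    have e3 : ((2 * (k + 1) + 1).factorial : ℂ) = Nat.doubleFactorial (2 * 1 + 2 * k + 1) *
        (2 ^ (k + 1) * ((k + 1) * k.factorial)) := by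
      rw [e2, Nat.factorial_succ]; push_cast; ring
    have n1 : ((2 * (k + 1)).factorial : ℂ) ≠ 0 := Nat.cast_ne_zero.2 (Nat.factorial_ne_zero _)
    have n2 : (k.factorial : ℂ) ≠ 0 := Nat.cast_ne_zero.2 (Nat.factorial_ne_zero _)
    have n3 : (Nat.doubleFactorial (2 * 1 + 2 * k + 1) : ℂ) ≠ 0 :=
      Nat.cast_ne_zero.2 (Nat.doubleFactorial_pos _).ne'
    have n4 : (2 * k + 3 : ℂ) ≠ 0 := by exact_mod_cast (by omega : 2 * k + 3 ≠ 0)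
    have n5 : (k + 1 : ℂ) ≠ 0 := by exact_mod_cast k.succ_ne_zero
    have e4 : ((2 * (k + 1)).factorial : ℂ) = Nat.doubleFactorial (2 * 1 + 2 * k + 1) *
        (2 ^ (k + 1) * ((k + 1) * k.factorial)) / (2 * k + 3) := by
      rw [← e3, e1, mul_div_cancel_left₀ _ n4]
    rw [e3, e4, neg_pow (w ^ 2 / 2), div_pow]
    field_simp
    ring
  simp only [hterm] at h
  rw [sphericalBesselJ, ← tsum_mul_left, ← tsum_mul_left, h.tsum_eq]
  simp [hw]

variable {x : ℝ}

theorem evenKernel_eq_pairKernel (x : ℝ) (n : ℕ) (ρ : ℂ) :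
    evenKernel x n ρ = pairKernel 1 0 n (ρ * x / Real.pi) := by
  simp [evenKernel, pairKernel]

theorem halfKernel_eq_pairKernel (x : ℝ) (n : ℕ) (ρ : ℂ) :
    halfKernel x n ρ = pairKernel (-1) (-1 / 2) n (ρ * x / Real.pi) := by
  simp only [halfKernel, pairKernel]
  push_cast
  ring_nf

theorem sinc_two_mul (u : ℂ) : sinc (2 * u) = Complex.cos (Real.pi * u) * sinc u := by
  have hp : (Real.pi : ℂ) ≠ 0 := Complex.ofReal_ne_zero.2 Real.pi_ne_zero
  rcases eq_or_ne u 0 with rfl | hu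
  · simp
  · rw [sinc, sinc, if_neg hu, if_neg (mul_ne_zero two_ne_zero hu), mul_left_comm,
      Complex.sin_two_mul]
    field_simp

/-- Doubling the argument of sinc splits off a cosine, which at half-integer shifts is ±sin ρx. The
division by sin ρx in the series for S' undoes precisely this factor. -/
theorem oddKernel_eq (x : ℝ) (n : ℕ) (ρ : ℂ) :
    oddKernel x n ρ = (-1) ^ n * Complex.sin (ρ * x) * halfKernel x n ρ := by
  have hp : (Real.pi : ℂ) ≠ 0 := Complex.ofReal_ne_zero.2 Real.pi_ne_zero
  have h1 : (2 * ρ * x / Real.pi - 2 * n - 1 : ℂ) = 2 * (ρ * x / Real.pi - 1 / 2 - (n : ℤ)) := by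
    push_cast; ring
  have h2 : (2 * ρ * x / Real.pi + 2 * n + 1 : ℂ) = 2 * (ρ * x / Real.pi + 1 / 2 + (n : ℤ)) := by
    push_cast; ring
  have e1 : Complex.cos (Real.pi * (ρ * x / Real.pi - 1 / 2 - (n : ℤ))) =
      (-1) ^ n * Complex.sin (ρ * x) := by
    rw [show (Real.pi * (ρ * x / Real.pi - 1 / 2 - (n : ℤ)) : ℂ) =
      ρ * x - Real.pi / 2 - n * Real.pi by push_cast; field_simp,
      Complex.cos_antiperiodic.sub_nat_mul_eq, Complex.cos_sub_pi_div_two]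
  have e2 : Complex.cos (Real.pi * (ρ * x / Real.pi + 1 / 2 + (n : ℤ))) =
      -((-1) ^ n * Complex.sin (ρ * x)) := by
    rw [show (Real.pi * (ρ * x / Real.pi + 1 / 2 + (n : ℤ)) : ℂ) =
      ρ * x + Real.pi / 2 + n * Real.pi by push_cast; field_simp,
      Complex.cos_antiperiodic.add_nat_mul_eq, Complex.cos_add_pi_div_two, mul_neg]
  rw [oddKernel, h1, h2, sinc_two_mul, sinc_two_mul, e1, e2, halfKernel]
  ring

theorem abs_im_mul_div_le (hx : 0 < x) {ρ : ℂ} {R : ℝ} (h : |ρ.im| ≤ R) :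
    |(ρ * x / Real.pi).im| ≤ R * (x / Real.pi) := by
  have : (ρ * x / Real.pi).im = ρ.im * (x / Real.pi) := by
    rw [mul_div_assoc, ← Complex.ofReal_div, Complex.im_mul_ofReal]
  rw [this, abs_mul, abs_of_pos (div_pos hx Real.pi_pos)]
  gcongr

theorem exists_sum_sq_evenKernel_le (hx : 0 < x) (R : ℝ) : ∃ B : ℝ, ∀ ρ : ℂ, |ρ.im| ≤ R →
    ∀ s : Finset ℕ, ∑ n ∈ s, ‖evenKernel x n ρ‖ ^ 2 ≤ B := by
  refine ⟨4 * Real.exp (R * (x / Real.pi) * Real.pi) ^ 2, fun ρ hρ s => ?_⟩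
  simp only [evenKernel_eq_pairKernel]
  exact sum_sq_pairKernel_le (by simp) 0 (abs_im_mul_div_le hx hρ) s

theorem exists_sum_sq_halfKernel_le (hx : 0 < x) (R : ℝ) : ∃ B : ℝ, ∀ ρ : ℂ, |ρ.im| ≤ R →
    ∀ s : Finset ℕ, ∑ n ∈ s, ‖halfKernel x n ρ‖ ^ 2 ≤ B := by
  refine ⟨4 * Real.exp (R * (x / Real.pi) * Real.pi) ^ 2, fun ρ hρ s => ?_⟩
  simp only [halfKernel_eq_pairKernel]
  exact sum_sq_pairKernel_le (by simp) _ (abs_im_mul_div_le hx hρ) s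

theorem norm_sin_mul_le (ρ : ℂ) {R : ℝ} (hρ : |ρ.im| ≤ R) (hx : 0 < x) :
    ‖Complex.sin (ρ * x)‖ ≤ Real.exp (R * x) := by
  have h1 := norm_exp_I_mul_le hρ (abs_of_pos hx).le
  have h2 := norm_exp_I_mul_le (z := -ρ) (by simpa using hρ) (abs_of_pos hx).le
  rw [Complex.sin, norm_div, Complex.norm_two, norm_mul, Complex.norm_I, mul_one]
  have h3 := norm_sub_le (Complex.exp (-(ρ * x) * Complex.I)) (Complex.exp (ρ * x * Complex.I))
  rw [show ρ * x * Complex.I = Complex.I * ρ * x by ring,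
    show -(ρ * x) * Complex.I = Complex.I * -ρ * x by ring] at *
  linarith

theorem lintegral_sq_sum_evenKernel_le (hx : 0 < x) (s : Finset ℕ) (a : ℕ → ℂ) :
    ∫⁻ t : ℝ, ‖∑ n ∈ s, a n * evenKernel x n t‖ₑ ^ 2 ≤
      ENNReal.ofReal (4 * (x / Real.pi)⁻¹ * ∑ n ∈ s, ‖a n‖ ^ 2) := by
  have := lintegral_sq_sum_pairKernel_le (e := 1) (by simp) 0 (div_pos hx Real.pi_pos) s a
  simpa [evenKernel_eq_pairKernel, mul_div_assoc] using this

theorem lintegral_sq_sum_halfKernel_le (hx : 0 < x) (s : Finset ℕ) (a : ℕ → ℂ) :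
    ∫⁻ t : ℝ, ‖∑ n ∈ s, a n * halfKernel x n t‖ₑ ^ 2 ≤
      ENNReal.ofReal (4 * (x / Real.pi)⁻¹ * ∑ n ∈ s, ‖a n‖ ^ 2) := by
  have := lintegral_sq_sum_pairKernel_le (e := -1) (by simp) (-1 / 2) (div_pos hx Real.pi_pos) s a
  simpa [halfKernel_eq_pairKernel, mul_div_assoc] using this

theorem exists_sum_sq_halfKernel_div_le (hx : 0 < x) (R : ℝ) : ∃ B : ℝ, 0 ≤ B ∧
    ∀ ρ : ℂ, |ρ.im| ≤ R → ∀ s : Finset ℕ, ∑ n ∈ s, ‖halfKernel x n ρ / ρ‖ ^ 2 ≤ B := by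
  refine ⟨4 * (Real.exp (R * x) * x) ^ 2, by positivity, fun ρ hρ s => ?_⟩
  rcases eq_or_ne ρ 0 with rfl | h0
  · simp only [div_zero, norm_zero, ne_eq, OfNat.ofNat_ne_zero, not_false_eq_true, zero_pow,
      Finset.sum_const_zero]
    positivity
  · exact (isParsevalKernel_half hx).sum_sq_le hx h0 (fun t ht => norm_sinDiv_le hρ ht)
      (by fun_prop) s

/-- For |t| > 1 the division by t only decreases the sum, so the orthonormality bound applies. On
[-1, 1] Cauchy–Schwarz and the strip bound with R = 0 give a constant, and the length of the
interval accounts for the factor 2. -/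
theorem exists_lintegral_sq_sum_halfKernel_div_le (hx : 0 < x) : ∃ B : ℝ, 0 ≤ B ∧
    ∀ (s : Finset ℕ) (a : ℕ → ℂ), ∫⁻ t : ℝ, ‖∑ n ∈ s, a n * (halfKernel x n t / t)‖ₑ ^ 2 ≤
      ENNReal.ofReal (B * ∑ n ∈ s, ‖a n‖ ^ 2) := by
  obtain ⟨B₀, hB₀, hB⟩ := exists_sum_sq_halfKernel_div_le hx 0
  refine ⟨4 * (x / Real.pi)⁻¹ + 2 * B₀, by positivity, fun s a => ?_⟩
  have hs0 : 0 ≤ ∑ n ∈ s, ‖a n‖ ^ 2 := Finset.sum_nonneg fun _ _ => by positivity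
  set K : ENNReal := ENNReal.ofReal (B₀ * ∑ n ∈ s, ‖a n‖ ^ 2) with hK
  have hpt : ∀ t : ℝ, ‖∑ n ∈ s, a n * (halfKernel x n t / t)‖ₑ ^ 2 ≤
      ‖∑ n ∈ s, a n * halfKernel x n t‖ₑ ^ 2 + (Icc (-1 : ℝ) 1).indicator (fun _ => K) t := by
    intro t
    by_cases ht : t ∈ Icc (-1 : ℝ) 1
    · rw [indicator_of_mem ht, ← ofReal_norm, ← ENNReal.ofReal_pow (norm_nonneg _)]
      refine le_add_of_nonneg_of_le zero_le (ENNReal.ofReal_le_ofReal ?_)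
      calc _ ≤ (∑ n ∈ s, ‖a n‖ * ‖halfKernel x n t / t‖) ^ 2 := by
            gcongr
            exact norm_sum_le_of_le _ fun n _ => (norm_mul _ _).le
        _ ≤ (∑ n ∈ s, ‖a n‖ ^ 2) * ∑ n ∈ s, ‖halfKernel x n t / t‖ ^ 2 :=
            Finset.sum_mul_sq_le_sq_mul_sq _ _ _
        _ ≤ (∑ n ∈ s, ‖a n‖ ^ 2) * B₀ := by
            gcongr
            exact hB t (by simp) s
        _ = _ := mul_comm _ _
    · rw [indicator_of_notMem ht, add_zero]
      have h1 : 1 ≤ |t| := by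
        by_contra h
        exact ht (abs_le.1 (not_le.1 h).le)
      simp only [← mul_div_assoc, ← Finset.sum_div]
      gcongr
      rw [← ofReal_norm, ← ofReal_norm, norm_div, Complex.norm_real, Real.norm_eq_abs]
      exact ENNReal.ofReal_le_ofReal (div_le_self (norm_nonneg _) h1)
  refine (lintegral_mono hpt).trans ?_
  rw [lintegral_add_right _ (measurable_const.indicator measurableSet_Icc),
    lintegral_indicator measurableSet_Icc, setLIntegral_const, Real.volume_Icc, hK,
    ← ENNReal.ofReal_mul (by positivity)]
  refine (add_le_add_left (lintegral_sq_sum_halfKernel_le hx s a) _).trans (le_of_eq ?_)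
  rw [← ENNReal.ofReal_add (by positivity) (by positivity)]
  congr 1
  ring

/-! ### Exceptional points and sampling points -/

theorem ae_mul_sin_ne_zero (hx : 0 < x) :
    ∀ᵐ t : ℝ, (t : ℂ) ∈ {ρ : ℂ | ρ * Complex.sin (ρ * x) ≠ 0} := by
  have hc : ({0} ∪ range fun k : ℤ => k * Real.pi / x).Countable :=
    (countable_singleton _).union (countable_range _)
  filter_upwards [hc.ae_notMem volume] with t ht
  simp only [mem_union, mem_singleton_iff, mem_range, not_or, not_exists] at ht
  refine mul_ne_zero (by exact_mod_cast ht.1) fun h => ?_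
  rw [← Complex.ofReal_mul, ← Complex.ofReal_sin, Complex.ofReal_eq_zero,
    Real.sin_eq_zero_iff] at h
  obtain ⟨k, hk⟩ := h
  exact ht.2 k (by rw [hk]; field_simp)

/-- The zeros of an entire function that does not vanish identically are isolated. -/
theorem eventually_mul_sin_ne_zero (hx : 0 < x) (ρ₀ : ℂ) :
    ∀ᶠ ρ in 𝓝[≠] ρ₀, ρ * Complex.sin (ρ * x) ≠ 0 := by
  have hd : AnalyticOnNhd ℂ (fun ρ : ℂ => ρ * Complex.sin (ρ * x)) univ :=
    DifferentiableOn.analyticOnNhd (fun ρ _ => by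
      apply DifferentiableAt.differentiableWithinAt; fun_prop) isOpen_univ
  rcases (hd ρ₀ (mem_univ _)).eventually_eq_zero_or_eventually_ne_zero with h | h
  · have h0 := hd.eqOn_zero_of_preconnected_of_eventuallyEq_zero isPreconnected_univ
      (mem_univ ρ₀) h
    have h1 : (Real.pi / (2 * x) : ℂ) * Complex.sin (Real.pi / (2 * x) * x) = 0 :=
      h0 (mem_univ _)
    have hp : (Real.pi : ℂ) ≠ 0 := Complex.ofReal_ne_zero.2 Real.pi_ne_zero
    have hx' : (x : ℂ) ≠ 0 := Complex.ofReal_ne_zero.2 hx.ne'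
    rw [show (Real.pi / (2 * x) * x : ℂ) = Real.pi / 2 by field_simp, Complex.sin_pi_div_two,
      mul_one] at h1
    exact absurd h1 (div_ne_zero hp (mul_ne_zero two_ne_zero hx'))
  · exact h

/-- The sampling points of the series for `S'`. -/
noncomputable def halfPoint (x : ℝ) (n : ℕ) : ℂ := (2 * n + 1) * Real.pi / (2 * x)

theorem halfPoint_mul (hx : 0 < x) (n : ℕ) : halfPoint x n * x = n * Real.pi + Real.pi / 2 := by
  have hx' : (x : ℂ) ≠ 0 := Complex.ofReal_ne_zero.2 hx.ne'
  rw [halfPoint]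
  field_simp

theorem halfPoint_ne_zero (hx : 0 < x) (n : ℕ) : halfPoint x n ≠ 0 := by
  have hp : (Real.pi : ℂ) ≠ 0 := Complex.ofReal_ne_zero.2 Real.pi_ne_zero
  have hx' : (x : ℂ) ≠ 0 := Complex.ofReal_ne_zero.2 hx.ne'
  exact div_ne_zero (mul_ne_zero (by exact_mod_cast (2 * n).succ_ne_zero) hp)
    (mul_ne_zero two_ne_zero hx')

theorem halfKernel_halfPoint (hx : 0 < x) (k m : ℕ) :
    halfKernel x k (halfPoint x m) / halfPoint x m =
      if k = m then (halfPoint x m)⁻¹ else 0 := by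
  have hp : (Real.pi : ℂ) ≠ 0 := Complex.ofReal_ne_zero.2 Real.pi_ne_zero
  have h1 : halfKernel x k (halfPoint x m) = if k = m then 1 else 0 := by
    rw [halfKernel, halfPoint_mul hx,
      show ((m * Real.pi + Real.pi / 2) / Real.pi - 1 / 2 - (k : ℤ) : ℂ) = ((m - k : ℤ) : ℂ) by
        push_cast; field_simp; ring,
      show ((m * Real.pi + Real.pi / 2) / Real.pi + 1 / 2 + (k : ℤ) : ℂ) = ((m + k + 1 : ℤ) : ℂ) by
        push_cast; field_simp; ring,
      sinc_intCast (k := m + k + 1) (by omega), sub_zero]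
    split_ifs with h
    · simp [h]
    · rw [sinc_intCast (by omega)]
  rw [h1]
  split_ifs <;> simp

theorem evenKernel_evenPoint (hx : 0 < x) (k m : ℕ) :
    evenKernel x k (m * Real.pi / x) =
      if k = m then (if m = 0 then 2 else 1) else 0 := by
  have hp : (Real.pi : ℂ) ≠ 0 := Complex.ofReal_ne_zero.2 Real.pi_ne_zero
  have hx' : (x : ℂ) ≠ 0 := Complex.ofReal_ne_zero.2 hx.ne'
  rw [evenKernel, show (m * Real.pi / x * x / Real.pi - k : ℂ) = ((m - k : ℤ) : ℂ) by
      push_cast; field_simp,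
    show (m * Real.pi / x * x / Real.pi + k : ℂ) = ((m + k : ℤ) : ℂ) by push_cast; field_simp]
  split_ifs with h h0
  · subst h; subst h0; norm_num
  · subst h; rw [sinc_intCast (k := k + k) (by omega)]; simp
  · rw [sinc_intCast (by omega), sinc_intCast (by omega), add_zero]

/-! ### The series for S' -/

section Sine

variable {L : ℝ} {q : ℝ → ℂ} {S : ℂ → ℝ → ℂ}

/-- `S'(ρ, x)` without its leading terms. -/
noncomputable def sineRemainder (L : ℝ) (q : ℝ → ℂ) (S : ℂ → ℝ → ℂ) (x : ℝ) (ρ : ℂ) : ℂ :=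
  xDeriv L (S ρ) x - Complex.cos (ρ * x) - omega q x * sinDiv ρ x

/-- At the half-integer points cos ρx = 0 and sin ρx = (-1)ⁿ, so of the leading terms only ω
survives. The coefficients are thus, up to 2(-1)ⁿ, the normalized samples of the remainder. -/
theorem sCoeff_eq (hx : 0 < x) (n : ℕ) : sCoeff L q S x n =
    2 * (-1) ^ n * (sineRemainder L q S x (halfPoint x n) / (halfPoint x n)⁻¹) := by
  have hx' : (x : ℂ) ≠ 0 := Complex.ofReal_ne_zero.2 hx.ne'
  have hs : Complex.sin (n * Real.pi + Real.pi / 2) = (-1) ^ n := by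
    rw [add_comm, Complex.sin_antiperiodic.add_nat_mul_eq, Complex.sin_pi_div_two, mul_one]
  have hc : Complex.cos (n * Real.pi + Real.pi / 2) = 0 := by
    rw [Complex.cos_add_pi_div_two, Complex.sin_nat_mul_pi, neg_zero]
  have h2 : ((-1 : ℂ) ^ n) ^ 2 = 1 := by rw [← pow_mul, mul_comm, pow_mul]; simp
  rw [sineRemainder, sinDiv_eq (halfPoint_ne_zero hx n), halfPoint_mul hx, hs, hc, div_inv_eq_mul,
    sub_zero, sub_mul, mul_assoc (omega q x), div_mul_cancel₀ _ (halfPoint_ne_zero hx n), sCoeff,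
    ← halfPoint]
  rw [show (-1) ^ n * (2 * n + 1) * Real.pi / x = 2 * (-1) ^ n * halfPoint x n by
    rw [halfPoint]; field_simp]
  linear_combination 2 * omega q x * h2

theorem sCoeff_mul_oddKernel (hx : 0 < x) (n : ℕ) {ρ : ℂ} (hρ : ρ * Complex.sin (ρ * x) ≠ 0) :
    1 / (2 * ρ * Complex.sin (ρ * x)) * (sCoeff L q S x n * oddKernel x n ρ) =
      sineRemainder L q S x (halfPoint x n) / (halfPoint x n)⁻¹ * (halfKernel x n ρ / ρ) := by
  have h2 : ((-1 : ℂ) ^ n) ^ 2 = 1 := by rw [← pow_mul, mul_comm, pow_mul]; simp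
  have h0 := left_ne_zero_of_mul hρ
  have h1 := right_ne_zero_of_mul hρ
  rw [sCoeff_eq hx, oddKernel_eq]
  generalize sineRemainder L q S x (halfPoint x n) / (halfPoint x n)⁻¹ = f
  field_simp
  linear_combination f * halfKernel x n ρ * h2

variable (hL : 0 < L) (hq : MemLp q 2 (volume.restrict (Icc 0 L))) (hx : x ∈ Ioc 0 L)
  (hS : ∀ ρ : ℂ, IsSolution L q ρ 0 1 (S ρ))

include hL hq hx hS

theorem summable_sq_sineRemainder :
    Summable fun n => ‖sineRemainder L q S x (halfPoint x n) / (halfPoint x n)⁻¹‖ ^ 2 :=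
  summable_sq_samples hx.1 (isL2Bounded_sine hL hq hx hS) (isParsevalKernel_half hx.1)
    (halfPoint_ne_zero hx.1) (fun m => inv_ne_zero (halfPoint_ne_zero hx.1 m))
    (halfKernel_halfPoint hx.1)

theorem xDeriv_sine_eq {ρ : ℂ} (hρ : ρ * Complex.sin (ρ * x) ≠ 0) :
    xDeriv L (S ρ) x = Complex.cos (ρ * x) + omega q x / ρ * Complex.sin (ρ * x) +
      1 / (2 * ρ * Complex.sin (ρ * x)) *
        ∑' n : ℕ, sCoeff L q S x n * oddKernel x n ρ := by
  have h0 := left_ne_zero_of_mul hρ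
  have h := hasSum_samples hx.1 (isL2Bounded_sine hL hq hx hS) (isParsevalKernel_half hx.1)
    (halfPoint_ne_zero hx.1) (fun m => inv_ne_zero (halfPoint_ne_zero hx.1 m))
    (halfKernel_halfPoint hx.1) h0
  rw [← tsum_mul_left, tsum_congr fun n => sCoeff_mul_oddKernel hx.1 n hρ]
  have h2 : ∑' n, sineRemainder L q S x (halfPoint x n) / (halfPoint x n)⁻¹ *
      (halfKernel x n ρ / ρ) = sineRemainder L q S x ρ := h.tsum_eq
  rw [h2, sineRemainder, sinDiv_eq h0]
  ring

theorem continuous_xDeriv_sine : Continuous fun ρ => xDeriv L (S ρ) x := by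
  have h : Continuous (sineRemainder L q S x) :=
    (isL2Bounded_sine hL hq hx hS).continuous continuous_sinDiv
  have e : (fun ρ => xDeriv L (S ρ) x) = fun ρ =>
      sineRemainder L q S x ρ + Complex.cos (ρ * x) + omega q x * sinDiv ρ x := by
    ext ρ; rw [sineRemainder]; ring
  rw [e]
  fun_prop

theorem cardinalConvergence_odd :
    CardinalConvergence univ fun n ρ => sCoeff L q S x n * oddKernel x n ρ := by
  refine cardinalConvergence_of_bessel ?_ (fun R => ?_) ⟨4 * (x / Real.pi)⁻¹,
    by have := hx.1; positivity, fun s a => ?_⟩ (fun n => ?_) (by simp)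
  · have := (summable_sq_sineRemainder hL hq hx hS).mul_left 4
    refine this.congr fun n => ?_
    rw [sCoeff_eq hx.1, norm_mul, norm_mul, norm_pow]
    simp
    ring
  · obtain ⟨B, hB⟩ := exists_sum_sq_halfKernel_le hx.1 R
    refine ⟨Real.exp (R * x) ^ 2 * B, fun ρ _ hρ s => ?_⟩
    have hsin := norm_sin_mul_le ρ hρ hx.1
    calc _ = ‖Complex.sin (ρ * x)‖ ^ 2 * ∑ n ∈ s, ‖halfKernel x n ρ‖ ^ 2 := by
          rw [Finset.mul_sum]
          refine Finset.sum_congr rfl fun n _ => ?_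
          rw [oddKernel_eq, norm_mul, norm_mul, norm_pow]
          simp
          ring
      _ ≤ _ := by
          refine mul_le_mul (by gcongr) (hB ρ hρ s) (Finset.sum_nonneg fun _ _ => by positivity)
            (by positivity)
  · have h := lintegral_sq_sum_halfKernel_le hx.1 s fun n => a n * (-1) ^ n
    simp only [norm_mul, norm_pow, norm_neg, norm_one, one_pow, mul_one] at h
    refine (lintegral_mono fun t => ?_).trans h
    rw [show ∑ n ∈ s, a n * oddKernel x n t =
        Complex.sin (t * x) * ∑ n ∈ s, a n * (-1) ^ n * halfKernel x n t by
      rw [Finset.mul_sum]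
      exact Finset.sum_congr rfl fun n _ => by rw [oddKernel_eq]; ring]
    gcongr
    rw [enorm_mul]
    refine mul_le_of_le_one_left' ?_
    rw [← ofReal_norm, ← Complex.ofReal_mul, ← Complex.ofReal_sin, Complex.norm_real]
    exact ENNReal.ofReal_le_one.2 (Real.abs_sin_le_one _)
  · exact ((continuous_sinc.comp (by fun_prop)).add
      (continuous_sinc.comp (by fun_prop))).measurable

theorem cardinalConvergence_half :
    CardinalConvergence {ρ : ℂ | ρ * Complex.sin (ρ * x) ≠ 0} fun n ρ =>
      1 / (2 * ρ * Complex.sin (ρ * x)) * (sCoeff L q S x n * oddKernel x n ρ) := by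
  have hx0 := hx.1
  set w : ℕ → ℂ → ℂ := fun n ρ =>
    1 / (2 * ρ * Complex.sin (ρ * x)) * (2 * (-1) ^ n * oddKernel x n ρ) with hw
  -- At the excluded points division by zero gives 0, so the global functions on ℝ are still
  -- dominated by the half-integer kernels.
  have hwe : ∀ n ρ, w n ρ = if ρ * Complex.sin (ρ * x) = 0 then 0 else halfKernel x n ρ / ρ := by
    intro n ρ
    simp only [hw]
    split_ifs with h
    · rw [mul_assoc 2, h]; simp
    · have h2 : ((-1 : ℂ) ^ n) ^ 2 = 1 := by rw [← pow_mul, mul_comm, pow_mul]; simp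
      have h0 := left_ne_zero_of_mul h
      have h1 := right_ne_zero_of_mul h
      rw [oddKernel_eq]
      field_simp
      linear_combination halfKernel x n ρ * h2
  have key : CardinalConvergence {ρ : ℂ | ρ * Complex.sin (ρ * x) ≠ 0} fun n ρ =>
      sineRemainder L q S x (halfPoint x n) / (halfPoint x n)⁻¹ * w n ρ := by
    obtain ⟨C, hC0, hC⟩ := exists_lintegral_sq_sum_halfKernel_div_le hx0
    refine cardinalConvergence_of_bessel (summable_sq_sineRemainder hL hq hx hS) (fun R => ?_)
      ⟨C, hC0, fun s a => ?_⟩ (fun n => ?_) (ae_mul_sin_ne_zero hx0)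
    · obtain ⟨B, -, hB⟩ := exists_sum_sq_halfKernel_div_le hx0 R
      refine ⟨B, fun ρ hρ hR s => ?_⟩
      have hρ' : ¬ ρ * Complex.sin (ρ * x) = 0 := hρ
      simp only [hwe, if_neg hρ']
      exact hB ρ hR s
    · refine (lintegral_mono fun t => ?_).trans (hC s a)
      simp only [hwe]
      split_ifs with h
      · simp
      · exact le_rfl
    · have h1 : Continuous fun t : ℝ => 2 * (-1) ^ n * oddKernel x n t :=
        continuous_const.mul ((continuous_sinc.comp (by fun_prop)).add
          (continuous_sinc.comp (by fun_prop)))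
      have h2 : Continuous fun t : ℝ => 2 * (t : ℂ) * Complex.sin (t * x) := by fun_prop
      exact (measurable_const.div h2.measurable).mul h1.measurable
  convert key using 3 with n ρ
  rw [sCoeff_eq hx0]
  simp only [hw]
  ring

end Sine

/-! ### The series for φ' -/

section Cosine

variable {L : ℝ} {q : ℝ → ℂ} {h : ℂ} {φ : ℂ → ℝ → ℂ}

/-- `φ'(ρ, x)` without its leading terms. -/
noncomputable def cosineRemainder (L : ℝ) (q : ℝ → ℂ) (h : ℂ) (φ : ℂ → ℝ → ℂ) (x : ℝ) (ρ : ℂ) :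
    ℂ :=
  xDeriv L (φ ρ) x + ρ * Complex.sin (ρ * x) - (h + omega q x) * Complex.cos (ρ * x)

/-- At nπ/x the sine vanishes and cos ρx = (-1)ⁿ. The weight 2 at n = 0 reflects that the two sinc
functions coincide there, and the extra (h+ω)/2 compensates for writing the leading term with j₁
instead of the cosine. -/
theorem phiCoeff_eq (hx : 0 < x) (n : ℕ) : phiCoeff L q h φ x n =
    cosineRemainder L q h φ x (n * Real.pi / x) / (if n = 0 then 2 else 1) +
      if n = 0 then (h + omega q x) / 2 else 0 := by
  have hx' : (x : ℂ) ≠ 0 := Complex.ofReal_ne_zero.2 hx.ne'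
  rw [phiCoeff, cosineRemainder]
  split_ifs with hn
  · subst hn; simp; ring
  · rw [div_mul_cancel₀ _ hx', Complex.sin_nat_mul_pi, show Complex.cos (n * Real.pi) = (-1) ^ n by
      rw [← zero_add (n * Real.pi : ℂ), Complex.cos_antiperiodic.add_nat_mul_eq, Complex.cos_zero,
        mul_one]]
    ring

variable (hL : 0 < L) (hq : MemLp q 2 (volume.restrict (Icc 0 L))) (hx : x ∈ Ioc 0 L)
  (hφ : ∀ ρ : ℂ, IsSolution L q ρ 1 h (φ ρ))

include hL hq hx hφ

/-- The sampling series of the remainder leaves (h+ω) cos ρx. The extra n = 0 term contributes (h+ω)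
sinc(ρx/π), and the difference of sinc and cosine is ρx j₁(ρx). -/
theorem xDeriv_cosine_eq (ρ : ℂ) :
    xDeriv L (φ ρ) x = -ρ * Complex.sin (ρ * x) -
      (h + omega q x) * ρ * x * sphericalBesselJ 1 (ρ * x) +
      ∑' n : ℕ, phiCoeff L q h φ x n * evenKernel x n ρ := by
  have hp : (Real.pi : ℂ) ≠ 0 := Complex.ofReal_ne_zero.2 Real.pi_ne_zero
  have h1 := hasSum_samples hx.1 (isL2Bounded_cosine hL hq hx hφ) (isParsevalKernel_even hx.1)
    (fun _ => mem_univ _) (d := fun m => if m = 0 then 2 else 1) (fun m => by split_ifs <;> simp)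
    (evenKernel_evenPoint hx.1) (mem_univ ρ)
  have h2 := hasSum_ite_eq (0 : ℕ) ((h + omega q x) / 2 * evenKernel x 0 ρ)
  have h3 : HasSum (fun n => phiCoeff L q h φ x n * evenKernel x n ρ)
      (cosineRemainder L q h φ x ρ + (h + omega q x) / 2 * evenKernel x 0 ρ) := by
    refine (h1.add h2).congr_fun fun n => ?_
    rw [phiCoeff_eq hx.1, add_mul]
    congr 1
    split_ifs with hn
    · rw [hn]
    · simp
  have hj := mul_sphericalBesselJ_one (ρ * x / Real.pi)
  rw [mul_div_cancel₀ _ hp] at hj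
  rw [h3.tsum_eq, cosineRemainder, evenKernel]
  simp only [Nat.cast_zero, sub_zero, add_zero]
  linear_combination (h + omega q x) * hj

theorem cardinalConvergence_even :
    CardinalConvergence univ fun n ρ => phiCoeff L q h φ x n * evenKernel x n ρ := by
  have hx0 := hx.1
  refine cardinalConvergence_of_bessel ?_ (fun R => ?_) ⟨4 * (x / Real.pi)⁻¹,
    by positivity, lintegral_sq_sum_evenKernel_le hx0⟩ (fun n => ?_) (by simp)
  · have h1 := summable_sq_samples hx.1 (isL2Bounded_cosine hL hq hx hφ)
      (isParsevalKernel_even hx.1) (fun _ => mem_univ _) (d := fun m => if m = 0 then 2 else 1)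
      (fun m => by split_ifs <;> simp) (evenKernel_evenPoint hx.1)
    -- The coefficients differ from the normalized samples only at n = 0, which does not affect
    -- summability.
    rw [← summable_nat_add_iff 1] at h1 ⊢
    refine h1.congr fun n => ?_
    rw [phiCoeff_eq hx0]
    simp [cosineRemainder]
  · obtain ⟨B, hB⟩ := exists_sum_sq_evenKernel_le hx0 R
    exact ⟨B, fun ρ _ => hB ρ⟩
  · exact ((continuous_sinc.comp (by fun_prop)).add
      (continuous_sinc.comp (by fun_prop))).measurable

end Cosine

end CardinalSeries

/-! ### The main theorem -/

theorem mainTheorem4 (L : ℝ) (hL : 0 < L) (q : ℝ → ℂ)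
    (hq : MemLp q 2 (volume.restrict (Icc 0 L))) (h : ℂ)
    (S φ : ℂ → ℝ → ℂ)
    (hS : ∀ ρ : ℂ, CardinalSeries.IsSolution L q ρ 0 1 (S ρ))
    (hφ : ∀ ρ : ℂ, CardinalSeries.IsSolution L q ρ 1 h (φ ρ))
    (x : ℝ) (hx : x ∈ Ioc 0 L) :
    -- the series for `S'`, for `ρ` off the zeros of `ρ sin(ρx)`
    (∀ ρ : ℂ, ρ * Complex.sin (ρ * x) ≠ 0 →
      CardinalSeries.xDeriv L (S ρ) x =
        Complex.cos (ρ * x) + CardinalSeries.omega q x / ρ * Complex.sin (ρ * x) +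
        1 / (2 * ρ * Complex.sin (ρ * x)) *
          ∑' n : ℕ, CardinalSeries.sCoeff L q S x n * CardinalSeries.oddKernel x n ρ) ∧
    -- at the zeros of `ρ sin(ρx)` the right-hand side is understood as its limit
    (∀ ρ₀ : ℂ, Tendsto (fun ρ : ℂ =>
        Complex.cos (ρ * x) + CardinalSeries.omega q x / ρ * Complex.sin (ρ * x) +
        1 / (2 * ρ * Complex.sin (ρ * x)) *
          ∑' n : ℕ, CardinalSeries.sCoeff L q S x n * CardinalSeries.oddKernel x n ρ)
      (𝓝[≠] ρ₀) (𝓝 (CardinalSeries.xDeriv L (S ρ₀) x))) ∧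
    -- the convergence of the series, without and with the factor `1 / (2ρ sin(ρx))`
    CardinalSeries.CardinalConvergence univ
      (fun n ρ => CardinalSeries.sCoeff L q S x n * CardinalSeries.oddKernel x n ρ) ∧
    CardinalSeries.CardinalConvergence {ρ : ℂ | ρ * Complex.sin (ρ * x) ≠ 0}
      (fun n ρ => 1 / (2 * ρ * Complex.sin (ρ * x)) *
        (CardinalSeries.sCoeff L q S x n * CardinalSeries.oddKernel x n ρ)) ∧
    -- the series for `φ'`
    (∀ ρ : ℂ, CardinalSeries.xDeriv L (φ ρ) x =
        -ρ * Complex.sin (ρ * x) -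
        (h + CardinalSeries.omega q x) * ρ * x * CardinalSeries.sphericalBesselJ 1 (ρ * x) +
        ∑' n : ℕ, CardinalSeries.phiCoeff L q h φ x n * CardinalSeries.evenKernel x n ρ) ∧
    CardinalSeries.CardinalConvergence univ
      (fun n ρ => CardinalSeries.phiCoeff L q h φ x n * CardinalSeries.evenKernel x n ρ) := by
  refine ⟨fun ρ hρ => CardinalSeries.xDeriv_sine_eq hL hq hx hS hρ, fun ρ₀ => ?_,
    CardinalSeries.cardinalConvergence_odd hL hq hx hS,
    CardinalSeries.cardinalConvergence_half hL hq hx hS,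
    CardinalSeries.xDeriv_cosine_eq hL hq hx hφ,
    CardinalSeries.cardinalConvergence_even hL hq hx hφ⟩
  -- The left-hand side is continuous in ρ and agrees with the series expression in a punctured
  -- neighbourhood of ρ₀, which gives the limit.
  refine Tendsto.congr' ?_ (((CardinalSeries.continuous_xDeriv_sine hL hq hx hS).tendsto
    ρ₀).mono_left nhdsWithin_le_nhds)
  filter_upwards [CardinalSeries.eventually_mul_sin_ne_zero hx.1 ρ₀] with ρ hρ
  exact CardinalSeries.xDeriv_sine_eq hL hq hx hS hρ
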